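/- **Setting.** Let $V$ be a finite-dimensional real vector space, $I$ a finite set, $(\alpha_i)_{i\in I}$ a linearly independent family in $V^*$ and $(\alpha_i^\vee)_{i\in I}$ a family in $V$ with $\alpha_i(\alpha_i^\vee)=2$. Put $r_i(v)=v-\alpha_i(v)\alpha_i^\vee$, let $W^v\subset GL(V)$ be the group generated by the $r_i$, and let $\Phi=\{w\alpha_i\}$ be the set of real roots, $\Phi^+=\Phi\cap\bigoplus_i\mathbb R_{\ge0}\alpha_i$. Assume the usual properties: $W^v$ is a Coxeter group with generators $r_i$ and Coxeter matrix $(\mathrm{ord}(r_ir_j))_{i,j}$; $r_\alpha:=wr_iw^{-1}$ depends only on $\alpha=w\alpha_i$; $\Phi=\Phi^+\sqcup-\Phi^+$; only $1\in W^v$ stabilizes $\Phi^+$; $w\alpha_i\in\Phi^+\Leftrightarrow\ell(wr_i)>\ell(w)$; and $\Phi\cap\mathbb R_{\ge0}\alpha=\{\alpha\}$ for $\alpha\in\Phi$. Let $\Delta_{im}\subset V^*\setminus\{0\}$ be a set of imaginary roots, disjoint from $\mathbb R\Phi$, stable under $\pm W^v$ and moderately imaginary: $\Delta_{im}=\Delta_{im}^+\cup-\Delta_{im}^+$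 with $\Delta_{im}^+=\Delta_{im}\cap\bigoplus_i\mathbb R_{\ge0}\alpha_i$ stable under $W^v$. Put $\Delta=\Phi\cup\Delta_{im}$. For $J\subset I$ let $F^v(J)=\{v:\alpha_i(v)=0\ (i\in J),\ \alpha_i(v)>0\ (i\notin J)\}$; the vectorial facets are the sets $\pm wF^v(J)$, $w\in W^v$; such a facet is spherical if $\langle r_i: i\in J\rangle$ is finite. The Tits cone is $\mathcal T=\bigcup_{w,J}wF^v(J)$, with interior $\mathcal T^\circ$. The model apartment $\mathbb A$ is an affine space under $V$ with a set $\mathcal M$ of affine hyperplanes (walls), each of direction $\ker\alpha$ for some $\alpha\in\Phi$, infinitely many for each $\alpha\in\Phi$, and stable under the group $W$ generated by the reflections $r_M$, $M\in\mathcal M$ (with hyperplane $M$ and linear part $r_\alpha$ if $M$ has direction $\ker\alpha$). Imaginary walls are all hyperplanes of direction $\ker\alpha$, $\alpha\in\Delta_{im}$. On $\mathbb A$, $x\le y$ means $y-x\in\mathcal T$ and $x\mathrel{\overset{\circ}{\le}}y$ means $y-x\in\mathcal T^\circ\cup\{0\}$. Subsets are identified with principal filters; a filter $F$ is contained in a filter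 $F'$ if $F'\subset F$ as collections of sets (so $F$ is contained in a set $S$ iff $S\in F$); a map fixes a filter if it is the identity on one of its elements. For $\alpha\in\Delta$, let $D(\alpha)$ run through $\mathbb A$ and the closed half-spaces $\{\alpha\ge c\}$ bounded by a wall (real if $\alpha\in\Phi$, imaginary if $\alpha\in\Delta_{im}$). The enclosure $cl(F)$ of a filter $F$ is the filter of sets containing an element of $F$ of the form $\bigcap_{\alpha\in\Delta}D(\alpha)$. The facet $F(x,F^v)$, for $x\in\mathbb A$ and a vectorial facet $F^v$, is the filter of sets containing an intersection over $\alpha\in\Delta$ of such half-spaces, closed or open, which contains a neighbourhood of $x$ in $x+F^v$ (that is, which contains $germ_x(x+F^v)$). The chimney with base a facet $F$ and direction a vectorial facet $F^v$ is $\mathfrak r=cl(F+F^v)$; its germ is the filter of sets containing (an element of) some $cl(F+\xi+F^v)$, $\xi\in\overline{F^v}$. The chimney, or its germ, is flared if $F^v$ is spherical, full if no proper affine subspace contains $\mathfrak r$, and solid if the direction of the smallest affine subspace containing $\mathfrak r$ has finite pointwise stabilizer in $W^v$. For $x\ne y$ with $x\le y$ or $y\le x$, the germ at $x$ of $[x,y]\setminus\{x\}$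 is a preordered interval germ; if $x\mathrel{\overset{\circ}{\le}}y$ or $y\mathrel{\overset{\circ}{\le}}x$, the half-line from $x$ through $y$ is generic. An affine hovel (masure affine) of type $\mathbb A$ is a set $\mathcal I$ covered by a set of subsets called apartments, such that: (MA1) each apartment $A$ carries a nonempty set $\mathrm{Isom}(\mathbb A,A)$ of bijections $\mathbb A\to A$ forming one orbit $f_0\circ W$; isomorphisms $A\to A'$ are the bijections carrying $\mathrm{Isom}(\mathbb A,A)$ to $\mathrm{Isom}(\mathbb A,A')$, and all notions above are transported to $A$ (giving $\le_A$, $\overset{\circ}{\le}_A$, segments $[x,y]_A$, $cl_A$, facets, chimneys, …); (MA2) if $F$ is a point, a preordered interval germ, a generic half-line or a solid chimney of an apartment $A$, and an apartment $A'$ contains $F$, then $A\cap A'$ contains $cl_A(F)$ and some isomorphism $A\to A'$ fixes $cl_A(F)$; (MA3) if $\mathfrak R$ is a flared chimney germ and $F$ a facet or a solid chimney germ, some apartment contains $\mathfrak R$ and $F$; (MA4) if two apartments $A,A'$ contain $\mathfrak R$ and $F$ as in (MA3), then $A\cap A'$ contains $cl_A(\mathfrak R\cup F)$ and some isomorphism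 $A\to A'$ fixes it. **Statement.** Let $\mathcal I$ be an affine hovel, $A$ an apartment and $\mathfrak R$ the germ of a full flared chimney of $A$. There is exactly one map $\rho=\rho_{A,\mathfrak R}:\mathcal I\to A$, the retraction onto $A$ with centre $\mathfrak R$, such that for every $x\in\mathcal I$ there are an apartment $A_x$ containing $\mathfrak R$ and $x$ and an isomorphism $\varphi:A_x\to A$ fixing $\mathfrak R$, and $\rho(x)=\varphi(x)$ for every such $A_x$ and $\varphi$. Let $x,y$ be two points of an apartment $A'$. 1. If $x\le_{A'}y$, there is a subdivision $z_0=x,z_1,\dots,z_n=y$ of the segment $[x,y]_{A'}$ such that $\rho([z_{i-1},z_i]_{A'})=[\rho z_{i-1},\rho z_i]_A$ and $\rho z_{i-1}\le_A\rho z_i$ for $1\le i\le n$; thus $\rho([x,y]_{A'})$ is the broken line $[\rho z_0,\rho z_1]_A\cup\dots\cup[\rho z_{n-1},\rho z_n]_A$. Moreover $\rho x\le_A\rho y$. 2. The same holds with $\overset{\circ}{\le}$ in place of $\le$ throughout: if $x\mathrel{\overset{\circ}{\le}_{A'}}y$, there is such a subdivision with $\rho z_{i-1}\mathrel{\overset{\circ}{\le}_A}\rho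 z_i$ for all $i$, and $\rho x\mathrel{\overset{\circ}{\le}_A}\rho y$. -/

import Mathlib

open Set Filter Topology

noncomputable section

/-- Simple roots `α i ∈ V*` (linearly independent) and simple coroots `α i ∨ ∈ V`
with `α i (α i ∨) = 2`. -/
structure RootBasis (ι V : Type*) [NormedAddCommGroup V] [NormedSpace ℝ V] where
  root : ι → Module.Dual ℝ V
  coroot : ι → V
  root_coroot : ∀ i, root i (coroot i) = 2
  linearIndependent_root : LinearIndependent ℝ root

namespace RootBasis

variable {ι V : Type*} [NormedAddCommGroup V] [NormedSpace ℝ V] (B : RootBasis ι V)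

/-- The simple reflection `r_i (v) = v - α_i(v) α_i∨`. -/
def simpleRefl (i : ι) : V ≃ₗ[ℝ] V := Module.reflection (B.root_coroot i)

/-- The vectorial Weyl group `W^v`. -/
def vWeyl : Subgroup (V ≃ₗ[ℝ] V) := Subgroup.closure (range B.simpleRefl)

/-- The contragredient action on `V*`: `(w α)(v) = α (w⁻¹ v)`. -/
def dualAct (w : V ≃ₗ[ℝ] V) (α : Module.Dual ℝ V) : Module.Dual ℝ V :=
  α ∘ₗ (w⁻¹ : V ≃ₗ[ℝ] V).toLinearMap

/-- The set `Φ` of real roots. -/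
def realRoots : Set (Module.Dual ℝ V) :=
  {β | ∃ w ∈ B.vWeyl, ∃ i, β = dualAct w (B.root i)}

/-- The cone `⊕ ℝ⁺ α_i`. -/
def posCone [Fintype ι] : Set (Module.Dual ℝ V) :=
  {β | ∃ c : ι → ℝ, (∀ i, 0 ≤ c i) ∧ β = ∑ i, c i • B.root i}

/-- The set `Φ⁺` of positive real roots. -/
def posRoots [Fintype ι] : Set (Module.Dual ℝ V) := B.realRoots ∩ B.posCone

/-- The facet `F^v(J)` of the closed fundamental chamber. -/
def fundFacet (J : Set ι) : Set V :=
  {v | (∀ i ∈ J, B.root i v = 0) ∧ ∀ i ∉ J, 0 < B.root i v}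

/-- `J` is spherical: the group generated by the `r_i`, `i ∈ J`, is finite. -/
def IsSphericalType (J : Set ι) : Prop :=
  ((Subgroup.closure (B.simpleRefl '' J) : Subgroup (V ≃ₗ[ℝ] V)) : Set (V ≃ₗ[ℝ] V)).Finite

/-- `Fv` is a positive or negative vectorial facet `± w F^v(J)` of type `J`. -/
def IsFacetOfType (J : Set ι) (Fv : Set V) : Prop :=
  ∃ w ∈ B.vWeyl, Fv = w '' B.fundFacet J ∨ Fv = (fun v => -w v) '' B.fundFacet J

/-- Vectorial facets (of both signs). -/
def IsVFacet (Fv : Set V) : Prop := ∃ J, B.IsFacetOfType J Fv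

/-- Spherical vectorial facets (of both signs). -/
def IsSphericalVFacet (Fv : Set V) : Prop := ∃ J, B.IsSphericalType J ∧ B.IsFacetOfType J Fv

/-- The Tits cone. -/
def titsCone : Set V := ⋃ w ∈ B.vWeyl, ⋃ J : Set ι, w '' B.fundFacet J

end RootBasis

/-- The vectorial data underlying an apartment, with a moderately imaginary set of
imaginary roots. -/
structure ApartmentRootDatum (ι V : Type*) [Fintype ι] [NormedAddCommGroup V] [NormedSpace ℝ V]
    extends RootBasis ι V where
  /-- `W^v` is a Coxeter group with generators the `r_i`; its Coxeter matrix is given by the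
  orders of the `r_i r_j` (`0` stands for `∞`). -/
  coxeterMatrix : CoxeterMatrix ι
  coxeterSystem : CoxeterSystem coxeterMatrix toRootBasis.vWeyl
  simple_eq : ∀ i, (coxeterSystem.simple i : V ≃ₗ[ℝ] V) = toRootBasis.simpleRefl i
  coxeterMatrix_eq : ∀ i j, coxeterMatrix i j =
    orderOf (toRootBasis.simpleRefl i * toRootBasis.simpleRefl j)
  /-- The reflection `r_α = w r_i w⁻¹` only depends on the real root `α = w α_i`. -/
  refl_wellDefined : ∀ w ∈ toRootBasis.vWeyl, ∀ w' ∈ toRootBasis.vWeyl, ∀ i j,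
    RootBasis.dualAct w (root i) = RootBasis.dualAct w' (root j) →
      w * toRootBasis.simpleRefl i * w⁻¹ = w' * toRootBasis.simpleRefl j * w'⁻¹
  pos_or_neg : ∀ β ∈ toRootBasis.realRoots, β ∈ toRootBasis.posRoots ∨ -β ∈ toRootBasis.posRoots
  eq_one_of_stabilizes : ∀ w ∈ toRootBasis.vWeyl,
    RootBasis.dualAct w '' toRootBasis.posRoots = toRootBasis.posRoots → w = 1
  length_lt_iff : ∀ (w : toRootBasis.vWeyl) (i : ι),
    RootBasis.dualAct (w : V ≃ₗ[ℝ] V) (root i) ∈ toRootBasis.posRoots ↔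
      coxeterSystem.length w < coxeterSystem.length (w * coxeterSystem.simple i)
  reduced : ∀ β ∈ toRootBasis.realRoots, ∀ c : ℝ, 0 ≤ c → c • β ∈ toRootBasis.realRoots →
    c • β = β
  /-- The set `Δ_im` of imaginary roots. -/
  imagRoots : Set (Module.Dual ℝ V)
  imag_ne_zero : ∀ β ∈ imagRoots, β ≠ 0
  imag_ne_smul_real : ∀ β ∈ imagRoots, ∀ γ ∈ toRootBasis.realRoots, ∀ c : ℝ, β ≠ c • γ
  imag_act : ∀ w ∈ toRootBasis.vWeyl, ∀ β ∈ imagRoots, RootBasis.dualAct w β ∈ imagRoots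
  imag_neg : ∀ β ∈ imagRoots, -β ∈ imagRoots
  /-- Moderately imaginary case. -/
  imag_pos_or_neg : ∀ β ∈ imagRoots, β ∈ toRootBasis.posCone ∨ -β ∈ toRootBasis.posCone
  imag_pos_act : ∀ w ∈ toRootBasis.vWeyl, ∀ β ∈ imagRoots, β ∈ toRootBasis.posCone →
    RootBasis.dualAct w β ∈ toRootBasis.posCone

/-- The set `Δ = Φ ∪ Δ_im` of all roots. -/
def ApartmentRootDatum.allRoots {ι V : Type*} [Fintype ι] [NormedAddCommGroup V] [NormedSpace ℝ V]
    (D : ApartmentRootDatum ι V) : Set (Module.Dual ℝ V) := D.realRoots ∪ D.imagRoots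

section Walls

variable {ι V P : Type*} [NormedAddCommGroup V] [NormedSpace ℝ V]
  [MetricSpace P] [NormedAddTorsor V P]

/-- The affine hyperplane through `p` with direction `ker α`. -/
def wallThrough (α : Module.Dual ℝ V) (p : P) : AffineSubspace ℝ P :=
  AffineSubspace.mk' p (LinearMap.ker α)

/-- The closed half-space `α ≥ α(p)`. -/
def closedHalf (α : Module.Dual ℝ V) (p : P) : Set P := {x | 0 ≤ α (x -ᵥ p)}

/-- The open half-space `α > α(p)`. -/
def openHalf (α : Module.Dual ℝ V) (p : P) : Set P := {x | 0 < α (x -ᵥ p)}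

/-- The affine map fixing `p` with linear part `g`. -/
def affineAt (g : V ≃ₗ[ℝ] V) (p : P) : P ≃ᵃ[ℝ] P :=
  ((AffineEquiv.vaddConst ℝ p).symm.trans g.toAffineEquiv).trans (AffineEquiv.vaddConst ℝ p)

/-- The affine Weyl group `W`, generated by the reflections `r_M` in the walls `M`:
if `M` contains `p` and has direction `ker (w α_i)`, then `r_M` fixes `p` and has linear
part `w r_i w⁻¹`. -/
def affineWeyl (B : RootBasis ι V) (walls : Set (AffineSubspace ℝ P)) :
    Subgroup (P ≃ᵃ[ℝ] P) :=
  Subgroup.closure {g | ∃ w ∈ B.vWeyl, ∃ (i : ι) (p : P),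
    wallThrough (RootBasis.dualAct w (B.root i)) p ∈ walls ∧
      g = affineAt (w * B.simpleRefl i * w⁻¹) p}

end Walls

/-- The model affine apartment: an affine space `P` under `V` with a set of (real) walls. -/
structure ModelApartment {ι V : Type*} [Fintype ι] [NormedAddCommGroup V] [NormedSpace ℝ V]
    (D : ApartmentRootDatum ι V) (P : Type*) [MetricSpace P] [NormedAddTorsor V P] where
  walls : Set (AffineSubspace ℝ P)
  exists_root : ∀ M ∈ walls, (M : Set P).Nonempty ∧
    ∃ α ∈ D.realRoots, M.direction = LinearMap.ker α
  infinite_walls : ∀ α ∈ D.realRoots, {M ∈ walls | M.direction = LinearMap.ker α}.Infinite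
  walls_stable : ∀ g ∈ affineWeyl D.toRootBasis walls, ∀ M ∈ walls,
    M.map (g : P →ᵃ[ℝ] P) ∈ walls

namespace ModelApartment

variable {ι V : Type*} [Fintype ι] [NormedAddCommGroup V] [NormedSpace ℝ V]
  {D : ApartmentRootDatum ι V} {P : Type*} [MetricSpace P] [NormedAddTorsor V P]
  (𝔸 : ModelApartment D P)

/-- The affine Weyl group `W` of the model apartment. -/
def weyl : Subgroup (P ≃ᵃ[ℝ] P) := affineWeyl D.toRootBasis 𝔸.walls

/-- The hyperplane of direction `ker α` through `p` is a real or an imaginary wall: for a real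
root it has to belong to the given set of walls, for an imaginary root all of them are allowed. -/
def IsWallOf (α : Module.Dual ℝ V) (p : P) : Prop :=
  (α ∈ D.realRoots ∧ wallThrough α p ∈ 𝔸.walls) ∨ α ∈ D.imagRoots

/-- The sets `D(α, k)` for `k ∈ Γ_α ∪ {∞}`. -/
def closedHalves (α : Module.Dual ℝ V) : Set (Set P) :=
  {H | H = univ ∨ ∃ p, 𝔸.IsWallOf α p ∧ H = closedHalf α p}

/-- The sets `D(α, k)` and `D°(α, k)` for `k ∈ Γ_α ∪ {∞}`. -/
def halves (α : Module.Dual ℝ V) : Set (Set P) :=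
  {H | H = univ ∨ ∃ p, 𝔸.IsWallOf α p ∧ (H = closedHalf α p ∨ H = openHalf α p)}

theorem halves_total (α : Module.Dual ℝ V) (H : Set P) (h : H ∈ 𝔸.halves α) (H' : Set P)
    (h' : H' ∈ 𝔸.halves α) : H ⊆ H' ∨ H' ⊆ H := by
  rcases h with rfl | ⟨p, -, hp⟩
  · exact Or.inr (subset_univ _)
  rcases h' with rfl | ⟨q, -, hq⟩
  · exact Or.inl (subset_univ _)
  have key : ∀ x : P, α (x -ᵥ q) = α (x -ᵥ p) + α (p -ᵥ q) := fun x => by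
    rw [← map_add, vsub_add_vsub_cancel]
  rcases lt_trichotomy (α (p -ᵥ q)) 0 with h | h | h
  · right
    rcases hp with rfl | rfl <;> rcases hq with rfl | rfl <;> intro x hx <;>
      simp only [closedHalf, openHalf, mem_ofPred_eq] at hx ⊢ <;> linarith [key x]
  · rcases hp with rfl | rfl
    · right
      rcases hq with rfl | rfl <;> intro x hx <;>
        simp only [closedHalf, openHalf, mem_ofPred_eq] at hx ⊢ <;> linarith [key x]
    · left
      rcases hq with rfl | rfl <;> intro x hx <;>
        simp only [closedHalf, openHalf, mem_ofPred_eq] at hx ⊢ <;> linarith [key x]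
  · left
    rcases hp with rfl | rfl <;> rcases hq with rfl | rfl <;> intro x hx <;>
      simp only [closedHalf, openHalf, mem_ofPred_eq] at hx ⊢ <;> linarith [key x]

theorem closedHalves_subset (α : Module.Dual ℝ V) : 𝔸.closedHalves α ⊆ 𝔸.halves α := by
  rintro H (h | ⟨p, hp, h⟩)
  · exact Or.inl h
  · exact Or.inr ⟨p, hp, Or.inl h⟩

/-- For a family `𝓗 α` of sets of half-spaces, the filter of all sets which contain an element
of `F` of the form `⋂_{α ∈ Δ} H_α` with `H_α ∈ 𝓗 α`. -/
def hullFilter (𝓗 : Module.Dual ℝ V → Set (Set P)) (huniv : ∀ α, univ ∈ 𝓗 α)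
    (h𝓗 : ∀ α, ∀ H ∈ 𝓗 α, ∀ H' ∈ 𝓗 α, H ⊆ H' ∨ H' ⊆ H) (F : Filter P) : Filter P where
  sets := {S | ∃ H : Module.Dual ℝ V → Set P, (∀ α ∈ D.allRoots, H α ∈ 𝓗 α) ∧
    (⋂ α ∈ D.allRoots, H α) ∈ F ∧ (⋂ α ∈ D.allRoots, H α) ⊆ S}
  univ_sets := ⟨fun _ => univ, fun α _ => huniv α, by simp, subset_univ _⟩
  sets_of_superset := by
    rintro S T ⟨H, h1, h2, h3⟩ hST
    exact ⟨H, h1, h2, h3.trans hST⟩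
  inter_sets := by
    rintro S T ⟨H, h1, h2, h3⟩ ⟨K, k1, k2, k3⟩
    have e : (⋂ α ∈ D.allRoots, H α ∩ K α) =
        (⋂ α ∈ D.allRoots, H α) ∩ ⋂ α ∈ D.allRoots, K α := by
      ext x
      simp only [mem_iInter, mem_inter_iff]
      exact ⟨fun h => ⟨fun α hα => (h α hα).1, fun α hα => (h α hα).2⟩,
        fun h α hα => ⟨h.1 α hα, h.2 α hα⟩⟩
    refine ⟨fun α => H α ∩ K α, fun α hα => ?_, ?_, ?_⟩
    · rcases h𝓗 α _ (h1 α hα) _ (k1 α hα) with h | h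
      · simpa only [inter_eq_left.2 h] using h1 α hα
      · simpa only [inter_eq_right.2 h] using k1 α hα
    · simpa only [e] using inter_mem h2 k2
    · simpa only [e] using inter_subset_inter h3 k3

/-- The enclosure `cl(F)`: the filter of all sets which contain an element of `F` of the form
`⋂_{α ∈ Δ} D(α, k_α)`. Subsets are identified with principal filters, so that inclusion of
filters is `≤`, and a filter `F` is contained in a set `S` when `S ∈ F`. -/
def cl (F : Filter P) : Filter P :=
  hullFilter (D := D) 𝔸.closedHalves (fun _ => Or.inl rfl)
    (fun α H h H' h' => 𝔸.halves_total α H (𝔸.closedHalves_subset α h) H'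
      (𝔸.closedHalves_subset α h')) F

/-- The local facet `germ_x (x + F^v)`. -/
def localFacet (x : P) (Fv : Set V) : Filter P := 𝓝[(fun v => v +ᵥ x) '' Fv] x

/-- The facet `F(x, F^v)`: the filter of all sets which contain an intersection of half-spaces
`D(α, k_α)` or `D°(α, k_α)` that contains the local facet. -/
def facet (x : P) (Fv : Set V) : Filter P :=
  hullFilter (D := D) 𝔸.halves (fun _ => Or.inl rfl) 𝔸.halves_total (localFacet x Fv)

/-- `cl(F + ξ + F^v)` for the facet `F = F(x, F₀^v)`. -/
def shiftedChimney (x : P) (F₀ Fv : Set V) (ξ : V) : Filter P :=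
  𝔸.cl (Filter.map₂ (fun p v => v +ᵥ (ξ +ᵥ p)) (𝔸.facet x F₀) (𝓟 Fv))

/-- The chimney `𝔯(F, F^v) = cl(F + F^v)` with base `F = F(x, F₀^v)` and direction `F^v`. -/
def chimney (x : P) (F₀ Fv : Set V) : Filter P :=
  𝔸.cl (Filter.map₂ (fun p v => v +ᵥ p) (𝔸.facet x F₀) (𝓟 Fv))

/-- The germ of a chimney: the filter of sets containing one of the shortenings
`cl(F + ξ + F^v)`, `ξ ∈ closure F^v` (a directed family). -/
def chimneyGerm (x : P) (F₀ Fv : Set V) : Filter P :=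
  ⨅ ξ ∈ closure Fv, 𝔸.shiftedChimney x F₀ Fv ξ

/-- The support of a filter: the smallest affine subspace containing it. -/
def support (F : Filter P) : AffineSubspace ℝ P :=
  sInf {E : AffineSubspace ℝ P | (E : Set P) ∈ F}

/-- The chimney is solid: the direction of its support has a finite fixer in `W^v`. -/
def IsSolid (r : Filter P) : Prop :=
  {w : V ≃ₗ[ℝ] V | w ∈ D.vWeyl ∧ ∀ u ∈ (support r).direction, w u = u}.Finite

/-- The chimney is full: its support is the whole apartment. -/
def IsFull (r : Filter P) : Prop := support r = ⊤

/-- The open interval germ `]x, y) = germ_x (]x, y])`. -/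
def intervalGerm (x y : P) : Filter P := 𝓝[AffineMap.lineMap x y '' Ioc (0 : ℝ) 1] x

/-- `x ≤ y` in the model apartment. -/
def Le (_𝔸 : ModelApartment D P) (x y : P) : Prop := y -ᵥ x ∈ D.titsCone

/-- `x ≤° y` in the model apartment. -/
def OpenLe (_𝔸 : ModelApartment D P) (x y : P) : Prop :=
  y -ᵥ x ∈ interior D.titsCone ∪ {0}

def IsPoint (G : Filter P) : Prop := ∃ x : P, G = 𝓟 {x}

/-- Germs of preordered intervals. -/
def IsPreorderedIntervalGerm (G : Filter P) : Prop :=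
  ∃ x y : P, x ≠ y ∧ (𝔸.Le x y ∨ 𝔸.Le y x) ∧ G = intervalGerm x y

/-- Generic half-lines (as principal filters). -/
def IsGenericRay (G : Filter P) : Prop :=
  ∃ x y : P, x ≠ y ∧ (𝔸.OpenLe x y ∨ 𝔸.OpenLe y x) ∧
    G = 𝓟 (AffineMap.lineMap x y '' Ici (0 : ℝ))

def IsFacet (G : Filter P) : Prop := ∃ (x : P) (Fv : Set V), D.IsVFacet Fv ∧ G = 𝔸.facet x Fv

def IsSolidChimney (G : Filter P) : Prop :=
  ∃ (x : P) (F₀ Fv : Set V), D.IsVFacet F₀ ∧ D.IsVFacet Fv ∧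
    IsSolid (D := D) (𝔸.chimney x F₀ Fv) ∧ G = 𝔸.chimney x F₀ Fv

def IsSolidChimneyGerm (G : Filter P) : Prop :=
  ∃ (x : P) (F₀ Fv : Set V), D.IsVFacet F₀ ∧ D.IsVFacet Fv ∧
    IsSolid (D := D) (𝔸.chimney x F₀ Fv) ∧ G = 𝔸.chimneyGerm x F₀ Fv

/-- Germs of flared chimneys: the direction is spherical. -/
def IsFlaredChimneyGerm (G : Filter P) : Prop :=
  ∃ (x : P) (F₀ Fv : Set V), D.IsVFacet F₀ ∧ D.IsSphericalVFacet Fv ∧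
    G = 𝔸.chimneyGerm x F₀ Fv

/-- Germs of full flared chimneys. -/
def IsFullFlaredChimneyGerm (G : Filter P) : Prop :=
  ∃ (x : P) (F₀ Fv : Set V), D.IsVFacet F₀ ∧ D.IsSphericalVFacet Fv ∧
    IsFull (𝔸.chimney x F₀ Fv) ∧ G = 𝔸.chimneyGerm x F₀ Fv

end ModelApartment

/-- A set covered by subsets (apartments), each with a structure of apartment of type `𝔸`,
that is a nonempty set `isom A` of bijections `𝔸 → A` which is a single orbit under `W`. -/
structure ApartmentSystem {ι V : Type*} [Fintype ι] [NormedAddCommGroup V] [NormedSpace ℝ V]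
    {D : ApartmentRootDatum ι V} {P : Type*} [MetricSpace P] [NormedAddTorsor V P]
    (𝔸 : ModelApartment D P) (X : Type*) where
  apartments : Set (Set X)
  sUnion_apartments : ⋃₀ apartments = univ
  isom : (A : Set X) → Set (P ≃ A)
  isom_nonempty : ∀ A ∈ apartments, (isom A).Nonempty
  isom_iff : ∀ A ∈ apartments, ∀ f₀ ∈ isom A, ∀ f : P ≃ A,
    f ∈ isom A ↔ ∃ w ∈ 𝔸.weyl, ∀ p, f p = f₀ (w p)

namespace ApartmentSystem

variable {ι V : Type*} [Fintype ι] [NormedAddCommGroup V] [NormedSpace ℝ V]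
  {D : ApartmentRootDatum ι V} {P : Type*} [MetricSpace P] [NormedAddTorsor V P]
  {𝔸 : ModelApartment D P} {X : Type*} (S : ApartmentSystem 𝔸 X)

/-- The transport to `X` of a filter on the model apartment. -/
def push {A : Set X} (f : P ≃ A) (G : Filter P) : Filter X := G.map (fun p => (f p : X))

/-- The filter `F` on `X` is, in the apartment `A`, an object of the kind `K`. -/
def IsKindIn (K : Filter P → Prop) (A : Set X) (F : Filter X) : Prop :=
  ∃ f ∈ S.isom A, ∃ G, K G ∧ F = push f G

/-- The filter `F` on `X` is, in some apartment, an object of the kind `K`. -/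
def IsKind (K : Filter P → Prop) (F : Filter X) : Prop :=
  ∃ A ∈ S.apartments, S.IsKindIn K A F

/-- Isomorphisms of apartments. -/
def IsIso {A A' : Set X} (φ : A ≃ A') : Prop := ∃ f ∈ S.isom A, f.trans φ ∈ S.isom A'

/-- `φ` fixes (pointwise) the filter `F`: it is the identity on some element of `F`. -/
def Fixes {A A' : Set X} (φ : A ≃ A') (F : Filter X) : Prop :=
  ∃ T ∈ F, ∀ a : A, (a : X) ∈ T → (φ a : X) = a

/-- The conclusion common to the axioms (MA2) and (MA4) for a filter `F` contained in `A`: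
`A ∩ A'` contains the enclosure `cl_A(F)` of `F` in `A` and there is an isomorphism of `A`
onto `A'` fixing this enclosure. -/
def EnclosureShared (A A' : Set X) (F : Filter X) : Prop :=
  ∀ f ∈ S.isom A,
    A ∩ A' ∈ push f (𝔸.cl (F.comap fun p => (f p : X))) ∧
      ∃ φ : A ≃ A', S.IsIso φ ∧ Fixes φ (push f (𝔸.cl (F.comap fun p => (f p : X))))

/-- The relation `≤_A` on the apartment `A`. -/
def Le (A : Set X) (x y : X) : Prop :=
  ∃ f ∈ S.isom A, ∃ p q : P, (f p : X) = x ∧ (f q : X) = y ∧ 𝔸.Le p q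

/-- The relation `≤°_A` on the apartment `A`. -/
def OpenLe (A : Set X) (x y : X) : Prop :=
  ∃ f ∈ S.isom A, ∃ p q : P, (f p : X) = x ∧ (f q : X) = y ∧ 𝔸.OpenLe p q

/-- The segment `[x, y]_A` in the apartment `A`. -/
def seg (A : Set X) (x y : X) : Set X :=
  {z | ∃ f ∈ S.isom A, ∃ p q r : P, (f p : X) = x ∧ (f q : X) = y ∧
    r ∈ affineSegment ℝ p q ∧ (f r : X) = z}

/-- `z₀ = x, z₁, …, z_n = y` is a subdivision of the segment `[x, y]_A`. -/
def IsSubdivision (A : Set X) (x y : X) {n : ℕ} (z : Fin (n + 1) → X) : Prop :=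
  ∃ f ∈ S.isom A, ∃ p q : P, (f p : X) = x ∧ (f q : X) = y ∧
    ∃ t : Fin (n + 1) → ℝ, Monotone t ∧ t 0 = 0 ∧ t (Fin.last n) = 1 ∧
      ∀ i, z i = f (AffineMap.lineMap p q (t i))

/-- `ρ` is the retraction of `X` onto `A` with centre `R`: for every `x` there is an apartment
`A'` containing `x` and `R` together with an isomorphism `φ : A' → A` fixing `R`, and
`ρ x = φ x` for all such `A'` and `φ`. -/
def IsRetraction (A : Set X) (R : Filter X) (ρ : X → A) : Prop :=
  ∀ x : X,
    (∃ A' ∈ S.apartments, A' ∈ R ∧ x ∈ A' ∧ ∃ φ : A' ≃ A, S.IsIso φ ∧ Fixes φ R) ∧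
    ∀ A' ∈ S.apartments, A' ∈ R → ∀ hx : x ∈ A', ∀ φ : A' ≃ A, S.IsIso φ → Fixes φ R →
      ρ x = φ ⟨x, hx⟩

/-- The image under `ρ` of the segment `[x, y]_{A'}` is a broken line in `A`, obtained from a
subdivision `z₀, …, z_n` of the segment, whose successive vertices `ρ z_i` increase for the
relation `rel`. -/
def MapsToIncreasingBrokenLine (A A' : Set X) (ρ : X → A) (rel : X → X → Prop) (x y : X) :
    Prop :=
  ∃ (n : ℕ) (z : Fin (n + 1) → X), S.IsSubdivision A' x y z ∧
    (fun u => (ρ u : X)) '' S.seg A' x y =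
      ⋃ i : Fin n, S.seg A (ρ (z i.castSucc)) (ρ (z i.succ)) ∧
    ∀ i : Fin n,
      (fun u => (ρ u : X)) '' S.seg A' (z i.castSucc) (z i.succ) =
        S.seg A (ρ (z i.castSucc)) (ρ (z i.succ)) ∧
      rel (ρ (z i.castSucc)) (ρ (z i.succ))

end ApartmentSystem

/-- Affine hovels (masures affines) of type `𝔸`. -/
structure AffineHovel {ι V : Type*} [Fintype ι] [NormedAddCommGroup V] [NormedSpace ℝ V]
    {D : ApartmentRootDatum ι V} {P : Type*} [MetricSpace P] [NormedAddTorsor V P]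
    (𝔸 : ModelApartment D P) (X : Type*) extends ApartmentSystem 𝔸 X where
  /-- (MA2) -/
  ma2 : ∀ A ∈ apartments, ∀ F : Filter X,
    toApartmentSystem.IsKindIn ModelApartment.IsPoint A F ∨
      toApartmentSystem.IsKindIn 𝔸.IsPreorderedIntervalGerm A F ∨
      toApartmentSystem.IsKindIn 𝔸.IsGenericRay A F ∨
      toApartmentSystem.IsKindIn 𝔸.IsSolidChimney A F →
    ∀ A' ∈ apartments, A' ∈ F → toApartmentSystem.EnclosureShared A A' F
  /-- (MA3) -/
  ma3 : ∀ R F : Filter X, toApartmentSystem.IsKind 𝔸.IsFlaredChimneyGerm R →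
    toApartmentSystem.IsKind 𝔸.IsFacet F ∨
      toApartmentSystem.IsKind 𝔸.IsSolidChimneyGerm F →
    ∃ A ∈ apartments, A ∈ R ∧ A ∈ F
  /-- (MA4) -/
  ma4 : ∀ R F : Filter X, toApartmentSystem.IsKind 𝔸.IsFlaredChimneyGerm R →
    toApartmentSystem.IsKind 𝔸.IsFacet F ∨
      toApartmentSystem.IsKind 𝔸.IsSolidChimneyGerm F →
    ∀ A ∈ apartments, A ∈ R → A ∈ F → ∀ A' ∈ apartments, A' ∈ R → A' ∈ F →
      toApartmentSystem.EnclosureShared A A' (R ⊔ F)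

end

/-! Existence of the retraction. The facet of smallest direction at a point `x` lies in every
apartment containing `x`, by (MA2) for points. (MA3) puts it in one apartment with the germ `R`, and
(MA4) with `R` in both roles maps that apartment onto `A` fixing `R`; this is allowed because a full
chimney is solid.

Independence of choices (`iso_apply_eq_of_fixes_germ`). For two choices at `x`, (MA4) gives an
isomorphism between the two apartments fixing both `R` and `x`. Composing, one gets an element of
`W` fixing `R`, and this must be the identity because `R` affinely spans the apartment. The spanning
property rests on `mem_chimney_of_mem_chimneyGerm`: as the direction is spherical, a parabolic
subgroup is finite, so every point of a suitable enclosure is pushed into the shortened chimney by a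
large translation along the direction.

Broken lines. On either side of a point of a preordered segment, the interval germ lies in a facet.
Some apartment contains this facet and `R`, and (MA2) identifies it with `A'` along the enclosure of
the germ. Hence `ρ` agrees with an isomorphism of apartments on a short segment
(`exists_isom_eq_retraction`). A supremum argument on `[0, 1]` yields a finite subdivision, and each
piece is carried to a segment whose direction is still in the Tits cone.

Finally, `ρ x ≤ ρ y` needs transitivity, that is, stability of the Tits cone under addition. This
follows from `mem_titsCone_iff`: the cone consists of the vectors at which only finitely many
positive real roots are negative. -/

namespace RootBasis

/-! ### Real roots, vectorial facets and parabolic subgroups. -/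

variable {ι V : Type*} [NormedAddCommGroup V] [NormedSpace ℝ V] (B : RootBasis ι V)

theorem dualAct_apply (w : V ≃ₗ[ℝ] V) (α : Module.Dual ℝ V) (v : V) :
    dualAct w α v = α (w⁻¹ v) := rfl

theorem dualAct_apply_apply (w : V ≃ₗ[ℝ] V) (α : Module.Dual ℝ V) (v : V) :
    dualAct w α (w v) = α v :=
  congrArg α (w.symm_apply_apply v)

theorem dualAct_mul (w w' : V ≃ₗ[ℝ] V) (α : Module.Dual ℝ V) :
    dualAct (w * w') α = dualAct w (dualAct w' α) := by
  ext v
  simp only [dualAct_apply, mul_inv_rev]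
  rfl

theorem dualAct_one (α : Module.Dual ℝ V) : dualAct (1 : V ≃ₗ[ℝ] V) α = α := by
  ext v
  simp only [dualAct_apply, inv_one]
  rfl

theorem dualAct_injective (w : V ≃ₗ[ℝ] V) : Function.Injective (dualAct w) := fun α β h => by
  simpa only [← dualAct_mul, inv_mul_cancel, dualAct_one] using congrArg (dualAct w⁻¹) h

theorem simpleRefl_apply (i : ι) (v : V) :
    B.simpleRefl i v = v - B.root i v • B.coroot i := rfl

theorem simpleRefl_mul_self (i : ι) : B.simpleRefl i * B.simpleRefl i = 1 := by
  ext v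
  exact Module.involutive_reflection (B.root_coroot i) v

theorem simpleRefl_inv (i : ι) : (B.simpleRefl i)⁻¹ = B.simpleRefl i :=
  inv_eq_of_mul_eq_one_left (B.simpleRefl_mul_self i)

theorem dualAct_simpleRefl_apply (i : ι) (α : Module.Dual ℝ V) (v : V) :
    dualAct (B.simpleRefl i) α v = α (B.simpleRefl i v) := by
  rw [dualAct_apply, simpleRefl_inv]

theorem dualAct_simpleRefl_involutive (i : ι) :
    Function.Involutive (dualAct (B.simpleRefl i)) := fun α => by
  rw [← dualAct_mul, simpleRefl_mul_self, dualAct_one]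

theorem root_simpleRefl (i : ι) (v : V) : B.root i (B.simpleRefl i v) = -B.root i v := by
  simp only [simpleRefl_apply, map_sub, map_smul, root_coroot, smul_eq_mul]
  ring

theorem simpleRefl_mem_vWeyl (i : ι) : B.simpleRefl i ∈ B.vWeyl :=
  Subgroup.subset_closure (mem_range_self i)

theorem dualAct_mem_realRoots {w : V ≃ₗ[ℝ] V} (hw : w ∈ B.vWeyl) {β : Module.Dual ℝ V}
    (hβ : β ∈ B.realRoots) : dualAct w β ∈ B.realRoots := by
  obtain ⟨w', hw', i, rfl⟩ := hβ
  exact ⟨w * w', mul_mem hw hw', i, (dualAct_mul _ _ _).symm⟩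

theorem root_mem_realRoots (i : ι) : B.root i ∈ B.realRoots :=
  ⟨1, one_mem _, i, (dualAct_one _).symm⟩

/-- The values of the simple roots on a vector may be prescribed. -/
theorem exists_root_eq [FiniteDimensional ℝ V] (c : ι → ℝ) : ∃ v : V, ∀ i, B.root i v = c i := by
  obtain ⟨g, hg⟩ := LinearMap.exists_extend
    ((Module.Basis.span B.linearIndependent_root).constr ℝ c)
  refine ⟨(Module.evalEquiv ℝ V).symm g, fun i => ?_⟩
  have h := congrArg (fun k => k (Module.Basis.span B.linearIndependent_root i)) hg
  rw [Module.Basis.constr_basis, LinearMap.comp_apply, Submodule.subtype_apply,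
    Module.Basis.span_apply] at h
  rw [← h]
  exact Module.apply_evalEquiv_symm_apply ℝ V (B.root i) g

theorem fundFacet_nonempty [FiniteDimensional ℝ V] (J : Set ι) : (B.fundFacet J).Nonempty := by
  classical
  obtain ⟨v, hv⟩ := B.exists_root_eq (fun i => if i ∈ J then 0 else 1)
  refine ⟨v, fun i hi => ?_, fun i hi => ?_⟩ <;> rw [hv] <;> simp [hi]

theorem add_mem_fundFacet [FiniteDimensional ℝ V] {J : Set ι} {u v : V}
    (hu : u ∈ closure (B.fundFacet J)) (hv : v ∈ B.fundFacet J) : u + v ∈ B.fundFacet J := by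
  refine ⟨fun i hi => ?_, fun i hi => ?_⟩
  · have hc : IsClosed {v : V | B.root i v = 0} :=
      isClosed_eq (LinearMap.continuous_of_finiteDimensional _) continuous_const
    have h0 : B.root i u = 0 := closure_minimal (fun v hv => hv.1 i hi) hc hu
    rw [map_add, h0, hv.1 i hi, add_zero]
  · have hc : IsClosed {v : V | 0 ≤ B.root i v} :=
      isClosed_le continuous_const (LinearMap.continuous_of_finiteDimensional _)
    have h0 : 0 ≤ B.root i u := closure_minimal (fun v hv => (hv.2 i hi).le) hc hu
    rw [map_add]
    exact add_pos_of_nonneg_of_pos h0 (hv.2 i hi)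

theorem smul_mem_fundFacet {J : Set ι} {v : V} (hv : v ∈ B.fundFacet J) {t : ℝ} (ht : 0 < t) :
    t • v ∈ B.fundFacet J := by
  refine ⟨fun i hi => ?_, fun i hi => ?_⟩ <;> rw [map_smul, smul_eq_mul]
  · rw [hv.1 i hi, mul_zero]
  · exact mul_pos ht (hv.2 i hi)

theorem zero_mem_fundFacet_univ : (0 : V) ∈ B.fundFacet univ :=
  ⟨fun _ _ => map_zero _, fun i hi => (hi (mem_univ i)).elim⟩

theorem isVFacet_fundFacet (J : Set ι) : B.IsVFacet (B.fundFacet J) :=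
  ⟨J, 1, one_mem _, Or.inl (image_id _).symm⟩

/-- A vectorial facet is the image of a facet of the fundamental chamber under a linear
automorphism `g = ± w`. -/
theorem IsFacetOfType.exists_linearEquiv {J : Set ι} {Fv : Set V} (h : B.IsFacetOfType J Fv) :
    ∃ g : V ≃ₗ[ℝ] V, Fv = g '' B.fundFacet J ∧
      (g ∈ B.vWeyl ∨ ∃ w ∈ B.vWeyl, ∀ v, g v = -w v) := by
  obtain ⟨w, hw, h | h⟩ := h
  · exact ⟨w, h, Or.inl hw⟩
  · exact ⟨w.trans (LinearEquiv.neg ℝ), h, Or.inr ⟨w, hw, fun _ => rfl⟩⟩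

namespace IsVFacet

variable {B} {Fv : Set V}

theorem exists_linearEquiv (h : B.IsVFacet Fv) :
    ∃ (g : V ≃ₗ[ℝ] V) (J : Set ι), Fv = g '' B.fundFacet J := by
  obtain ⟨J, h⟩ := h
  obtain ⟨g, hg, -⟩ := h.exists_linearEquiv
  exact ⟨g, J, hg⟩

theorem nonempty [FiniteDimensional ℝ V] (h : B.IsVFacet Fv) : Fv.Nonempty := by
  obtain ⟨g, J, rfl⟩ := h.exists_linearEquiv
  exact (B.fundFacet_nonempty J).image _

theorem smul_mem (h : B.IsVFacet Fv) {v : V} (hv : v ∈ Fv) {t : ℝ} (ht : 0 < t) :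
    t • v ∈ Fv := by
  obtain ⟨g, J, rfl⟩ := h.exists_linearEquiv
  obtain ⟨v, hv, rfl⟩ := hv
  exact ⟨t • v, B.smul_mem_fundFacet hv ht, map_smul g t v⟩

theorem add_mem [FiniteDimensional ℝ V] (h : B.IsVFacet Fv) {u v : V} (hu : u ∈ closure Fv)
    (hv : v ∈ Fv) : u + v ∈ Fv := by
  obtain ⟨g, J, rfl⟩ := h.exists_linearEquiv
  have hg : g '' closure (B.fundFacet J) = closure (g '' B.fundFacet J) :=
    g.toContinuousLinearEquiv.toHomeomorph.image_closure _
  rw [← hg] at hu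
  obtain ⟨u, hu, rfl⟩ := hu
  obtain ⟨v, hv, rfl⟩ := hv
  exact ⟨u + v, B.add_mem_fundFacet hu hv, map_add g u v⟩

theorem zero_mem_closure [FiniteDimensional ℝ V] (h : B.IsVFacet Fv) : (0 : V) ∈ closure Fv := by
  obtain ⟨v, hv⟩ := h.nonempty
  have h1 : Tendsto (fun t : ℝ => t • v) (𝓝[>] 0) (𝓝 0) := by
    have : Tendsto (fun t : ℝ => t • v) (𝓝 0) (𝓝 ((0 : ℝ) • v)) :=
      (continuous_id.smul continuous_const).tendsto 0
    rw [zero_smul] at this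
    exact this.mono_left nhdsWithin_le_nhds
  exact mem_closure_of_tendsto h1 (eventually_nhdsWithin_of_forall fun t ht => h.smul_mem hv ht)

theorem add_mem_closure [FiniteDimensional ℝ V] (h : B.IsVFacet Fv) {u v : V}
    (hu : u ∈ closure Fv) (hv : v ∈ closure Fv) : u + v ∈ closure Fv := by
  have hc : IsClosed {v : V | u + v ∈ closure Fv} :=
    isClosed_closure.preimage (continuous_const.add continuous_id)
  have hsub : Fv ⊆ {v : V | u + v ∈ closure Fv} := fun v hv => subset_closure (h.add_mem hu hv)
  exact closure_minimal hsub hc hv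

end IsVFacet

theorem IsSphericalVFacet.isVFacet {Fv : Set V} (h : B.IsSphericalVFacet Fv) : B.IsVFacet Fv :=
  h.imp fun _ h => h.2

/-- The standard parabolic subgroup `W^v(J)`. -/
def parabolic (J : Set ι) : Subgroup (V ≃ₗ[ℝ] V) := Subgroup.closure (B.simpleRefl '' J)

theorem parabolic_le (J : Set ι) : B.parabolic J ≤ B.vWeyl :=
  Subgroup.closure_mono (image_subset_range _ _)

theorem parabolic_univ : B.parabolic univ = B.vWeyl := by
  rw [parabolic, image_univ, vWeyl]

/-- The roots `w α_i` with `w ∈ W^v(J)` and `i ∈ J`. -/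
def parabolicRoots (J : Set ι) : Set (Module.Dual ℝ V) :=
  {β | ∃ w ∈ B.parabolic J, ∃ i ∈ J, β = dualAct w (B.root i)}

theorem parabolicRoots_subset (J : Set ι) : B.parabolicRoots J ⊆ B.realRoots := by
  rintro _ ⟨w, hw, i, -, rfl⟩
  exact ⟨w, B.parabolic_le J hw, i, rfl⟩

theorem dualAct_mem_parabolicRoots {J : Set ι} {w : V ≃ₗ[ℝ] V} (hw : w ∈ B.parabolic J)
    {β : Module.Dual ℝ V} (hβ : β ∈ B.parabolicRoots J) : dualAct w β ∈ B.parabolicRoots J := by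
  obtain ⟨w', hw', i, hi, rfl⟩ := hβ
  exact ⟨w * w', mul_mem hw hw', i, hi, (dualAct_mul _ _ _).symm⟩

theorem parabolic_fixes {J : Set ι} {w : V ≃ₗ[ℝ] V} (hw : w ∈ B.parabolic J) {v : V}
    (hv : ∀ i ∈ J, B.root i v = 0) : w v = v := by
  induction hw using Subgroup.closure_induction with
  | mem x hx =>
    obtain ⟨i, hi, rfl⟩ := hx
    rw [simpleRefl_apply, hv i hi, zero_smul, sub_zero]
  | one => rfl
  | mul x y _ _ hx hy =>
    change x (y v) = v
    rw [hy, hx]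
  | inv x _ hx =>
    nth_rw 1 [← hx]
    exact x.symm_apply_apply v

variable [Fintype ι]

theorem posCone_apply_nonneg {β : Module.Dual ℝ V} (hβ : β ∈ B.posCone) {v : V}
    (hv : ∀ i, 0 ≤ B.root i v) : 0 ≤ β v := by
  obtain ⟨c, hc, rfl⟩ := hβ
  simp only [LinearMap.sum_apply, LinearMap.smul_apply, smul_eq_mul]
  exact Finset.sum_nonneg fun i _ => mul_nonneg (hc i) (hv i)

theorem root_mem_posCone (i : ι) : B.root i ∈ B.posCone := by
  classical
  exact ⟨Pi.single i 1, fun j => by by_cases h : j = i <;> simp [h],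
    by simp [Pi.single_apply]⟩

theorem neg_root_notMem_posCone [FiniteDimensional ℝ V] (i : ι) : -B.root i ∉ B.posCone := by
  intro h
  obtain ⟨v, hv⟩ := B.exists_root_eq (fun _ => 1)
  have := B.posCone_apply_nonneg h (v := v) (fun j => by rw [hv]; exact zero_le_one)
  rw [LinearMap.neg_apply, hv] at this
  linarith

/-- Simple roots in `J` vanish on the facet and the others are strictly positive there, so all
depends on whether some coefficient outside `J` is nonzero. -/
theorem posCone_sign {J : Set ι} {β : Module.Dual ℝ V} (hβ : β ∈ B.posCone) :
    (∀ v ∈ B.fundFacet J, β v = 0) ∨ ∀ v ∈ B.fundFacet J, 0 < β v := by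
  obtain ⟨c, hc, rfl⟩ := hβ
  simp only [LinearMap.sum_apply, LinearMap.smul_apply, smul_eq_mul]
  by_cases h : ∀ j ∉ J, c j = 0
  · refine Or.inl fun v hv => Finset.sum_eq_zero fun i _ => ?_
    by_cases hi : i ∈ J
    · rw [hv.1 i hi, mul_zero]
    · rw [h i hi, zero_mul]
  · push Not at h
    obtain ⟨j, hj, hj0⟩ := h
    refine Or.inr fun v hv => Finset.sum_pos' (fun i _ => mul_nonneg (hc i) ?_)
      ⟨j, Finset.mem_univ j, mul_pos ((hc j).lt_of_ne' hj0) (hv.2 j hj)⟩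
    by_cases hi : i ∈ J
    · exact (hv.1 i hi).ge
    · exact (hv.2 i hi).le

end RootBasis

/-! ### Signs of roots and convexity of the Tits cone. -/

namespace ApartmentRootDatum

open RootBasis

variable {ι V : Type*} [Fintype ι] [NormedAddCommGroup V] [NormedSpace ℝ V]
  (D : ApartmentRootDatum ι V)

theorem allRoots_dualAct {w : V ≃ₗ[ℝ] V} (hw : w ∈ D.vWeyl) {β : Module.Dual ℝ V}
    (hβ : β ∈ D.allRoots) : dualAct w β ∈ D.allRoots :=
  hβ.imp (fun h => D.dualAct_mem_realRoots hw h) fun h => D.imag_act w hw β h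

theorem allRoots_pos_or_neg {β : Module.Dual ℝ V} (hβ : β ∈ D.allRoots) :
    β ∈ D.posCone ∨ -β ∈ D.posCone :=
  hβ.elim (fun h => (D.pos_or_neg β h).imp And.right And.right) (D.imag_pos_or_neg β)

theorem allRoots_neg {β : Module.Dual ℝ V} (hβ : β ∈ D.allRoots) : -β ∈ D.allRoots := by
  refine hβ.imp (fun h => ?_) (D.imag_neg β)
  obtain ⟨w, hw, i, rfl⟩ := h
  refine ⟨w * D.simpleRefl i, mul_mem hw (D.simpleRefl_mem_vWeyl i), i, ?_⟩
  rw [dualAct_mul]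
  ext v
  rw [dualAct_apply, dualAct_simpleRefl_apply, root_simpleRefl]
  rfl

theorem zero_mem_titsCone : (0 : V) ∈ D.titsCone := by
  simp only [titsCone, mem_iUnion]
  exact ⟨1, one_mem _, univ, 0, D.zero_mem_fundFacet_univ, rfl⟩

theorem smul_mem_titsCone {v : V} (hv : v ∈ D.titsCone) {t : ℝ} (ht : 0 ≤ t) :
    t • v ∈ D.titsCone := by
  rcases ht.eq_or_lt with rfl | ht
  · rw [zero_smul]
    exact D.zero_mem_titsCone
  · simp only [titsCone, mem_iUnion] at hv ⊢
    obtain ⟨w, hw, J, u, hu, rfl⟩ := hv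
    exact ⟨w, hw, J, t • u, D.smul_mem_fundFacet hu ht, map_smul w t u⟩

theorem map_mem_titsCone {w : V ≃ₗ[ℝ] V} (hw : w ∈ D.vWeyl) {v : V} (hv : v ∈ D.titsCone) :
    w v ∈ D.titsCone := by
  simp only [titsCone, mem_iUnion] at hv ⊢
  obtain ⟨w', hw', J, u, hu, rfl⟩ := hv
  exact ⟨w * w', mul_mem hw hw', J, u, hu, rfl⟩

theorem comp_mem_allRoots {g : V ≃ₗ[ℝ] V}
    (hg : g ∈ D.vWeyl ∨ ∃ w ∈ D.vWeyl, ∀ v, g v = -w v) {α : Module.Dual ℝ V}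
    (hα : α ∈ D.allRoots) : α ∘ₗ g.toLinearMap ∈ D.allRoots := by
  have key : ∀ w ∈ D.vWeyl, α ∘ₗ w.toLinearMap ∈ D.allRoots := fun w hw => by
    have := D.allRoots_dualAct (inv_mem hw) hα
    rwa [dualAct, inv_inv] at this
  obtain hg | ⟨w, hw, hgw⟩ := hg
  · exact key g hg
  · have : α ∘ₗ g.toLinearMap = -(α ∘ₗ w.toLinearMap) := by
      ext v
      simp [hgw]
    rw [this]
    exact D.allRoots_neg (key w hw)

/-- Pulling back by `g = ± w` reduces to the fundamental chamber, where every root, imaginary ones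
included, is a combination of simple roots with coefficients of one sign. -/
theorem sign_on_facet {Fv : Set V} (hF : D.IsVFacet Fv) {α : Module.Dual ℝ V}
    (hα : α ∈ D.allRoots) :
    (∀ v ∈ Fv, α v = 0) ∨ (∀ v ∈ Fv, 0 < α v) ∨ ∀ v ∈ Fv, α v < 0 := by
  obtain ⟨J, hF⟩ := hF
  obtain ⟨g, rfl, hg⟩ := hF.exists_linearEquiv
  simp only [forall_mem_image]
  rcases D.allRoots_pos_or_neg (D.comp_mem_allRoots hg hα) with h | h
  · exact (D.posCone_sign (J := J) h).imp id Or.inl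
  · refine (D.posCone_sign (J := J) h).imp (fun h v hv => ?_) fun h => Or.inr fun v hv => ?_
    · exact neg_eq_zero.1 (h v hv)
    · exact neg_pos.1 (h v hv)

theorem smul_mem_interior_titsCone {v : V} (hv : v ∈ interior D.titsCone) {t : ℝ} (ht : 0 < t) :
    t • v ∈ interior D.titsCone := by
  have ho : IsOpen ((fun x => t • x) '' interior D.titsCone) :=
    (Homeomorph.smulOfNeZero t ht.ne').isOpenMap _ isOpen_interior
  refine interior_maximal ?_ ho (mem_image_of_mem _ hv)
  exact image_subset_iff.2 fun x hx => D.smul_mem_titsCone (interior_subset hx) ht.le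

variable [FiniteDimensional ℝ V]

/-- The simple reflection `r_i` permutes the positive real roots other than `α_i`. -/
theorem dualAct_simpleRefl_mem_posCone {β : Module.Dual ℝ V} (hβ : β ∈ D.realRoots)
    (hβ' : β ∈ D.posCone) {i : ι} (hi : β ≠ D.root i) :
    dualAct (D.simpleRefl i) β ∈ D.posCone := by
  classical
  have hmem := D.dualAct_mem_realRoots (D.simpleRefl_mem_vWeyl i) hβ
  refine (D.pos_or_neg _ hmem).elim And.right fun hneg => (hi ?_).elim
  obtain ⟨c, hc, hβc⟩ := hβ'
  have hzero : ∀ j, j ≠ i → c j = 0 := by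
    intro j hj
    -- `α_i` vanishes on this dual vector, so `r_i` fixes it and `β`, `r_i β` agree there: the
    -- common value `c j` is both nonnegative and nonpositive.
    obtain ⟨v, hv⟩ := D.exists_root_eq (Pi.single j 1)
    have h1 := D.posCone_apply_nonneg hneg.2 (v := v) (fun k => by
      rw [hv]; by_cases h : k = j <;> simp [h])
    have h2 : β v = c j := by
      rw [hβc]
      simp [LinearMap.sum_apply, hv, Pi.single_apply]
    rw [LinearMap.neg_apply, dualAct_simpleRefl_apply, simpleRefl_apply, hv,
      Pi.single_eq_of_ne hj.symm, zero_smul, sub_zero, h2] at h1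
    linarith [hc j]
  have hβi : β = c i • D.root i := by
    rw [hβc]
    exact Finset.sum_eq_single i (fun j _ hj => by rw [hzero j hj, zero_smul]) (by simp)
  rw [hβi]
  exact D.reduced _ (D.root_mem_realRoots i) _ (hc i) (hβi ▸ hβ)

/-- The positive roots of `W^v(J)` which are negative at `v`. -/
def negativeAt (J : Set ι) (v : V) : Set (Module.Dual ℝ V) :=
  {β | β ∈ D.parabolicRoots J ∧ β ∈ D.posCone ∧ β v < 0}

/-- Apply `r_i`, which permutes the positive real roots other than `α_i`. It shows that a simple
reflection changes the set of negative roots by at most one element, up to bijection. -/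
theorem negativeAt_simpleRefl_subset {J : Set ι} {i : ι} (hi : i ∈ J) (v : V) :
    D.negativeAt J (D.simpleRefl i v) ⊆
      insert (D.root i) (dualAct (D.simpleRefl i) '' (D.negativeAt J v \ {D.root i})) := by
  rintro β ⟨h1, h2, h3⟩
  by_cases hβ : β = D.root i
  · exact Or.inl hβ
  refine Or.inr ⟨dualAct (D.simpleRefl i) β, ⟨⟨?_, ?_, ?_⟩, fun h => ?_⟩,
    D.dualAct_simpleRefl_involutive i β⟩
  · exact D.dualAct_mem_parabolicRoots (Subgroup.subset_closure (mem_image_of_mem _ hi)) h1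
  · exact D.dualAct_simpleRefl_mem_posCone (D.parabolicRoots_subset J h1) h2 hβ
  · rwa [dualAct_simpleRefl_apply]
  · apply D.neg_root_notMem_posCone i
    have : β = -D.root i := by
      rw [← D.dualAct_simpleRefl_involutive i β, mem_singleton_iff.1 h]
      ext u
      rw [dualAct_simpleRefl_apply, root_simpleRefl, LinearMap.neg_apply]
    rwa [← this]

/-- Induction on the number of negative roots: reflecting in a simple root negative at `v` makes
that root positive and permutes the rest, so the number drops. -/
theorem exists_parabolic_dominant (J : Set ι) (v : V) (hfin : (D.negativeAt J v).Finite) :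
    ∃ w ∈ D.parabolic J, ∀ i ∈ J, 0 ≤ D.root i (w v) := by
  induction hn : (D.negativeAt J v).ncard using Nat.strong_induction_on generalizing v with
  | _ n ih =>
    by_cases h : ∀ i ∈ J, 0 ≤ D.root i v
    · exact ⟨1, one_mem _, h⟩
    push Not at h
    obtain ⟨i, hi, hiv⟩ := h
    have hsub : D.negativeAt J (D.simpleRefl i v) ⊆
        dualAct (D.simpleRefl i) '' (D.negativeAt J v \ {D.root i}) := by
      intro β hβ
      refine (D.negativeAt_simpleRefl_subset hi v hβ).resolve_left ?_
      rintro rfl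
      have := hβ.2.2
      rw [root_simpleRefl] at this
      linarith
    have hfin' := (hfin.sdiff (t := {D.root i})).image (dualAct (D.simpleRefl i))
    have hmem : D.root i ∈ D.negativeAt J v :=
      ⟨⟨1, one_mem _, i, hi, (dualAct_one _).symm⟩, D.root_mem_posCone i, hiv⟩
    have hlt : (D.negativeAt J (D.simpleRefl i v)).ncard < n := by
      calc _ ≤ (dualAct (D.simpleRefl i) '' (D.negativeAt J v \ {D.root i})).ncard :=
            ncard_le_ncard hsub hfin'
        _ = (D.negativeAt J v \ {D.root i}).ncard :=
            ncard_image_of_injective _ (dualAct_injective _)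
        _ < n := hn ▸ ncard_sdiff_singleton_lt_of_mem hmem hfin
    obtain ⟨w, hw, hdom⟩ := ih _ hlt _ (hfin'.subset hsub) rfl
    exact ⟨w * D.simpleRefl i,
      mul_mem hw (Subgroup.subset_closure (mem_image_of_mem _ hi)), hdom⟩

/-- Dominant vectors have no negative roots and each simple reflection adds at most one; conversely,
finitely many negative roots can be reflected away. This form of the cone makes its convexity
visible. -/
theorem mem_titsCone_iff (v : V) : v ∈ D.titsCone ↔ (D.negativeAt univ v).Finite := by
  constructor
  · intro hv
    simp only [titsCone, mem_iUnion] at hv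
    obtain ⟨w, hw, J, u, hu, rfl⟩ := hv
    have hstep : ∀ i v, (D.negativeAt univ v).Finite →
        (D.negativeAt univ (D.simpleRefl i v)).Finite := fun i v h =>
      ((((h.sdiff (t := {D.root i})).image _).insert _).subset
        (D.negativeAt_simpleRefl_subset (mem_univ i) v))
    have hdom : (D.negativeAt univ u).Finite := by
      refine finite_empty.subset fun β hβ => ?_
      refine (hβ.2.2.not_ge (D.posCone_apply_nonneg hβ.2.1 fun i => ?_)).elim
      by_cases hi : i ∈ J
      · exact (hu.1 i hi).ge
      · exact (hu.2 i hi).le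
    induction hw using Subgroup.closure_induction_left with
    | one => exact hdom
    | mul_left x hx y _ ih =>
      obtain ⟨i, rfl⟩ := hx
      exact hstep i _ ih
    | inv_mul_cancel x hx y _ ih =>
      obtain ⟨i, rfl⟩ := hx
      rw [simpleRefl_inv]
      exact hstep i _ ih
  · intro h
    obtain ⟨w, hw, hdom⟩ := D.exists_parabolic_dominant univ v h
    rw [parabolic_univ] at hw
    simp only [titsCone, mem_iUnion]
    -- The type of the facet containing the dominant vector `w v` is the set of simple roots
    -- vanishing on it.
    refine ⟨w⁻¹, inv_mem hw, {i | D.root i (w v) = 0}, w v, ⟨fun i hi => hi, fun i hi => ?_⟩,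
      w.symm_apply_apply v⟩
    exact (hdom i (mem_univ i)).lt_of_ne' hi

/-- A root negative at `u + v` is negative at `u` or at `v`. -/
theorem add_mem_titsCone {u v : V} (hu : u ∈ D.titsCone) (hv : v ∈ D.titsCone) :
    u + v ∈ D.titsCone := by
  rw [mem_titsCone_iff] at hu hv ⊢
  refine (hu.union hv).subset fun β ⟨h1, h2, h3⟩ => ?_
  rw [map_add] at h3
  rcases lt_or_ge (β u) 0 with h | h
  · exact Or.inl ⟨h1, h2, h⟩
  · exact Or.inr ⟨h1, h2, by linarith⟩

theorem map_mem_interior_titsCone {w : V ≃ₗ[ℝ] V} (hw : w ∈ D.vWeyl) {v : V}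
    (hv : v ∈ interior D.titsCone) : w v ∈ interior D.titsCone := by
  have h : w '' interior D.titsCone = interior (w '' D.titsCone) :=
    w.toContinuousLinearEquiv.toHomeomorph.image_interior _
  have h2 : w '' D.titsCone ⊆ D.titsCone := image_subset_iff.2 fun v hv => D.map_mem_titsCone hw hv
  exact interior_mono h2 (h ▸ mem_image_of_mem w hv)

theorem add_mem_interior_titsCone {u v : V} (hu : u ∈ interior D.titsCone)
    (hv : v ∈ D.titsCone) : u + v ∈ interior D.titsCone := by
  have ho : IsOpen ((fun x => x + v) '' interior D.titsCone) :=
    (Homeomorph.addRight v).isOpenMap _ isOpen_interior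
  refine interior_maximal ?_ ho (mem_image_of_mem _ hu)
  exact image_subset_iff.2 fun x hx => D.add_mem_titsCone (interior_subset hx) hv

/-- If `J` is spherical and `η ∈ F^v(J)`, every vector is moved by a large multiple of `η` into
the cone where all roots positive on `F^v(J)` are nonnegative. -/
theorem exists_smul_add_nonneg_fundFacet {J : Set ι} (hJ : D.IsSphericalType J) {η : V}
    (hη : η ∈ D.fundFacet J) (u : V) :
    ∃ t : ℝ, 0 < t ∧ ∀ α ∈ D.allRoots, (∀ v ∈ D.fundFacet J, 0 < α v) → 0 ≤ α (u + t • η) := by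
  have hfinW : (D.parabolic J : Set (V ≃ₗ[ℝ] V)).Finite := hJ
  -- Sphericity enters here: as `W^v(J)` is finite, one `t` serves all its elements, in particular
  -- the `w` that is chosen later, depending on `t`.
  have hlarge : ∀ᶠ t : ℝ in atTop, ∀ w ∈ (D.parabolic J : Set (V ≃ₗ[ℝ] V)), ∀ j, j ∉ J →
      0 ≤ D.root j (w u) + t * D.root j η := by
    rw [eventually_all_finite hfinW]
    intro w _
    rw [eventually_all]
    intro j
    by_cases hj : j ∈ J
    · exact Eventually.of_forall fun t h => (h hj).elim
    · have h1 : Tendsto (fun t : ℝ => D.root j (w u) + t * D.root j η) atTop atTop :=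
        tendsto_atTop_add_const_left _ _ (tendsto_id.atTop_mul_const (hη.2 j hj))
      exact (h1.eventually_ge_atTop 0).mono fun t ht _ => ht
  obtain ⟨t, ht, ht0⟩ := (hlarge.and (eventually_gt_atTop 0)).exists
  refine ⟨t, ht0, fun α hα hpos => ?_⟩
  have hroots : (D.parabolicRoots J).Finite := by
    refine ((hfinW.prod (finite_univ (α := ι))).image
      fun x => dualAct x.1 (D.root x.2)).subset ?_
    rintro _ ⟨w, hw, i, -, rfl⟩
    exact ⟨(w, i), ⟨hw, mem_univ i⟩, rfl⟩
  obtain ⟨w, hw, hdom⟩ := D.exists_parabolic_dominant J (u + t • η)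
    (hroots.subset fun β hβ => hβ.1)
  have hwη : w η = η := D.parabolic_fixes hw hη.1
  -- `w` fixes `η`, so `w α` takes at the dominant vector `η` the positive value `α η`; this
  -- excludes the negative cone.
  have hwα : dualAct w α ∈ D.posCone := by
    refine (D.allRoots_pos_or_neg (D.allRoots_dualAct (D.parabolic_le J hw) hα)).resolve_right ?_
    intro hneg
    have h1 := D.posCone_apply_nonneg hneg (v := η) fun i => by
      by_cases hi : i ∈ J
      · exact (hη.1 i hi).ge
      · exact (hη.2 i hi).le
    rw [LinearMap.neg_apply, ← hwη, dualAct_apply_apply] at h1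
    linarith [hpos η hη]
  rw [← dualAct_apply_apply w α]
  refine D.posCone_apply_nonneg hwα fun i => ?_
  by_cases hi : i ∈ J
  · exact hdom i hi
  · rw [map_add, map_smul, hwη, map_add, map_smul, smul_eq_mul]
    exact ht w hw i hi

theorem exists_smul_add_nonneg {Fv : Set V} (hF : D.IsSphericalVFacet Fv) {η : V} (hη : η ∈ Fv)
    (u : V) :
    ∃ t : ℝ, 0 < t ∧ ∀ α ∈ D.allRoots, (∀ v ∈ Fv, 0 < α v) → 0 ≤ α (u + t • η) := by
  obtain ⟨J, hJ, hF⟩ := hF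
  obtain ⟨g, rfl, hg⟩ := hF.exists_linearEquiv
  obtain ⟨η, hη, rfl⟩ := hη
  obtain ⟨t, ht, h⟩ := D.exists_smul_add_nonneg_fundFacet hJ hη (g.symm u)
  refine ⟨t, ht, fun α hα hpos => ?_⟩
  have := h _ (D.comp_mem_allRoots hg hα) fun v hv => hpos _ (mem_image_of_mem g hv)
  simpa using this

end ApartmentRootDatum

/-! ### The model apartment: enclosures, facets, chimney germs and preorders. -/

theorem linear_mem_vWeyl_of_mem_affineWeyl {ι V P : Type*} [NormedAddCommGroup V]
    [NormedSpace ℝ V] [MetricSpace P] [NormedAddTorsor V P] {B : RootBasis ι V}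
    {walls : Set (AffineSubspace ℝ P)} {g : P ≃ᵃ[ℝ] P} (hg : g ∈ affineWeyl B walls) :
    g.linear ∈ B.vWeyl := by
  induction hg using Subgroup.closure_induction with
  | mem x hx =>
    obtain ⟨w, hw, i, p, -, rfl⟩ := hx
    have h : w * B.simpleRefl i * w⁻¹ ∈ B.vWeyl :=
      mul_mem (mul_mem hw (B.simpleRefl_mem_vWeyl i)) (inv_mem hw)
    exact h
  | one => exact one_mem _
  | mul x y _ _ hx hy => exact mul_mem hx hy
  | inv x _ hx => exact inv_mem hx

namespace ModelApartment

variable {ι V : Type*} [Fintype ι] [NormedAddCommGroup V] [NormedSpace ℝ V]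
  {D : ApartmentRootDatum ι V} {P : Type*} [MetricSpace P] [NormedAddTorsor V P]
  (𝔸 : ModelApartment D P)

theorem le_cl (F : Filter P) : F ≤ 𝔸.cl F := by
  rintro S ⟨H, -, h2, h3⟩
  exact mem_of_superset h2 h3

theorem cl_mono {F G : Filter P} (h : F ≤ G) : 𝔸.cl F ≤ 𝔸.cl G := by
  rintro S ⟨H, h1, h2, h3⟩
  exact ⟨H, h1, h h2, h3⟩

theorem localFacet_le_facet (x : P) (Fv : Set V) : localFacet x Fv ≤ 𝔸.facet x Fv := by
  rintro S ⟨H, -, h2, h3⟩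
  exact mem_of_superset h2 h3

theorem mem_of_mem_facet {x : P} {Fv : Set V} (h0 : (0 : V) ∈ Fv) {T : Set P}
    (hT : T ∈ 𝔸.facet x Fv) : x ∈ T :=
  mem_of_mem_nhdsWithin (s := (fun v : V => v +ᵥ x) '' Fv) ⟨0, h0, zero_vadd V x⟩
    (𝔸.localFacet_le_facet x Fv hT)

/-- The enclosure of a point contains the facet of minimal direction through it. -/
theorem facet_univ_le_cl_pure (x : P) : 𝔸.facet x (D.fundFacet univ) ≤ 𝔸.cl (𝓟 {x}) := by
  rintro S ⟨H, h1, h2, h3⟩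
  refine ⟨H, fun α hα => 𝔸.closedHalves_subset α (h1 α hα), ?_, h3⟩
  have hx := mem_iInter₂.1 (mem_principal.1 h2 (mem_singleton x))
  refine mem_of_superset self_mem_nhdsWithin ?_
  rintro _ ⟨v, hv, rfl⟩
  refine mem_iInter₂.2 fun α hα => ?_
  -- All simple roots, hence all roots, vanish on the minimal direction, so half-spaces through `x`
  -- contain its whole translate.
  have hα0 : α v = 0 := by
    have hv0 : ∀ i, D.root i v = 0 := fun i => hv.1 i (mem_univ i)
    rcases D.allRoots_pos_or_neg hα with ⟨c, -, h⟩ | ⟨c, -, h⟩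
    · rw [h]
      simp [LinearMap.sum_apply, hv0]
    · rw [← neg_eq_zero, ← LinearMap.neg_apply, h]
      simp [LinearMap.sum_apply, hv0]
  rcases h1 α hα with h | ⟨p, -, h⟩
  · rw [h]
    trivial
  · have := hx α hα
    rw [h] at this ⊢
    simpa only [closedHalf, mem_ofPred_eq, vadd_vsub_assoc, map_add, hα0, zero_add] using this

theorem facet_neBot [FiniteDimensional ℝ V] (x : P) {Fv : Set V} (hF : D.IsVFacet Fv) :
    (𝔸.facet x Fv).NeBot := by
  have hx : x ∈ closure ((fun v : V => v +ᵥ x) '' Fv) := by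
    have hc : Continuous fun v : V => v +ᵥ x := continuous_id.vadd continuous_const
    have := image_closure_subset_closure_image hc (mem_image_of_mem _ hF.zero_mem_closure)
    simpa only [zero_vadd] using this
  have : (localFacet x Fv).NeBot := mem_closure_iff_nhdsWithin_neBot.1 hx
  exact this.mono (𝔸.localFacet_le_facet x Fv)

/-- This lets (MA3), which speaks of facets, produce apartments containing interval germs. -/
theorem intervalGerm_le_facet {x y : P} {Fv : Set V} (hF : D.IsVFacet Fv) (h : y -ᵥ x ∈ Fv) :
    intervalGerm x y ≤ 𝔸.facet x Fv := by
  refine (nhdsWithin_mono x ?_).trans (𝔸.localFacet_le_facet x Fv)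
  rintro _ ⟨t, ht, rfl⟩
  exact ⟨t • (y -ᵥ x), hF.smul_mem h ht.1, (AffineMap.lineMap_apply x y t).symm⟩

theorem closedHalf_of_mem_closedHalves {α : Module.Dual ℝ V} {H : Set P}
    (hH : H ∈ 𝔸.closedHalves α) : H = univ ∨ ∃ p, H = closedHalf α p :=
  hH.imp id fun ⟨p, _, hp⟩ => ⟨p, hp⟩

theorem isClosed_of_mem_closedHalves [FiniteDimensional ℝ V] {α : Module.Dual ℝ V} {H : Set P}
    (hH : H ∈ 𝔸.closedHalves α) : IsClosed H := by
  rcases 𝔸.closedHalf_of_mem_closedHalves hH with rfl | ⟨p, rfl⟩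
  · exact isClosed_univ
  · have hα : Continuous α := LinearMap.continuous_of_finiteDimensional _
    exact isClosed_le continuous_const (hα.comp (continuous_id.vsub continuous_const))

/-- The enclosure of an interval germ contains the origin of the interval and a whole initial
segment. -/
theorem exists_lineMap_mem_of_mem_cl_intervalGerm [FiniteDimensional ℝ V] {x y : P} {T : Set P}
    (hT : T ∈ 𝔸.cl (intervalGerm x y)) :
    ∃ ε : ℝ, 0 < ε ∧ ∀ s ∈ Icc 0 ε, AffineMap.lineMap x y s ∈ T := by
  obtain ⟨H, h1, h2, h3⟩ := hT
  set Q := ⋂ α ∈ D.allRoots, H α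
  have hcont : Continuous (AffineMap.lineMap x y : ℝ → P) := AffineMap.lineMap_continuous
  have hlim : Tendsto (AffineMap.lineMap x y : ℝ → P) (𝓝[>] 0) (intervalGerm x y) := by
    refine tendsto_nhdsWithin_iff.2 ⟨?_, ?_⟩
    · have := hcont.tendsto 0
      rw [AffineMap.lineMap_apply_zero] at this
      exact this.mono_left nhdsWithin_le_nhds
    · filter_upwards [Ioc_mem_nhdsGT zero_lt_one] with t ht using mem_image_of_mem _ ht
  -- Closedness is what brings the origin `x`, omitted by the interval germ, into the enclosure.
  have hclosed : IsClosed Q :=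
    isClosed_biInter fun α hα => 𝔸.isClosed_of_mem_closedHalves (h1 α hα)
  have hx : x ∈ Q := by
    refine hclosed.mem_of_tendsto (hlim.mono_right nhdsWithin_le_nhds) (hlim.eventually h2)
  obtain ⟨ε, hε, hsub⟩ := mem_nhdsGT_iff_exists_Ioc_subset.1 (hlim h2)
  refine ⟨ε, hε, fun s hs => h3 ?_⟩
  rcases hs.1.eq_or_lt with rfl | h0
  · rwa [AffineMap.lineMap_apply_zero]
  · exact hsub ⟨h0, hs.2⟩

/-- An affine subspace containing the germ of a flared chimney contains the chimney itself. -/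
theorem mem_chimney_of_mem_chimneyGerm [FiniteDimensional ℝ V] {x : P} {F₀ Fv : Set V}
    (hF₀ : D.IsVFacet F₀) (hFv : D.IsSphericalVFacet Fv) {E : AffineSubspace ℝ P}
    (hE : (E : Set P) ∈ 𝔸.chimneyGerm x F₀ Fv) : (E : Set P) ∈ 𝔸.chimney x F₀ Fv := by
  classical
  have hF := hFv.isVFacet
  -- Adding an element of the closed facet to `ξ` shortens the chimney, so `ξ + ζ` dominates both
  -- `ξ` and `ζ`.
  have hdir : DirectedOn ((𝔸.shiftedChimney x F₀ Fv) ⁻¹'o (· ≥ ·)) (closure Fv) := by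
    have key : ∀ ξ, ∀ ζ ∈ closure Fv,
        𝔸.shiftedChimney x F₀ Fv (ξ + ζ) ≤ 𝔸.shiftedChimney x F₀ Fv ξ := by
      intro ξ ζ hζ
      refine 𝔸.cl_mono fun S hS => ?_
      obtain ⟨U, hU, Q, hQ, hUQ⟩ := mem_map₂_iff.1 hS
      refine mem_map₂_iff.2 ⟨U, hU, Fv, mem_principal_self _, ?_⟩
      rintro _ ⟨p, hp, v, hv, rfl⟩
      have := hUQ (mem_image2_of_mem hp (hQ (hF.add_mem hζ hv)))
      simp only [vadd_vadd] at this ⊢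
      convert this using 2
      abel
    intro ξ hξ ζ hζ
    refine ⟨ξ + ζ, hF.add_mem_closure hξ hζ, key ξ ζ hζ, ?_⟩
    have := key ζ ξ hξ
    rwa [add_comm] at this
  rw [chimneyGerm, mem_biInf_of_directed hdir ⟨0, hF.zero_mem_closure⟩] at hE
  obtain ⟨ξ, hξ, H, h1, h2, h3⟩ := hE
  obtain ⟨U, hU, Q, hQ, hUQ⟩ := mem_map₂_iff.1 h2
  have hUF : ∀ b ∈ U, ∀ v ∈ Fv, ∀ α ∈ D.allRoots, v +ᵥ (ξ +ᵥ b) ∈ H α := fun b hb v hv α hα =>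
    mem_iInter₂.1 (hUQ (mem_image2_of_mem hb (hQ hv))) α hα
  -- Keep only the half-spaces whose root vanishes on `Fv`. They do not feel the shift `ξ`, so they
  -- contain the unshifted `F + Fv`; it remains to see that their intersection lies in `E`.
  refine ⟨fun α => if ∀ v ∈ Fv, α v = 0 then H α else univ, fun α hα => ?_, ?_, fun q hq => ?_⟩
  · dsimp only
    split_ifs
    · exact h1 α hα
    · exact Or.inl rfl
  · refine mem_map₂_iff.2 ⟨U, hU, Fv, mem_principal_self _, ?_⟩
    rintro _ ⟨b, hb, v, hv, rfl⟩
    refine mem_iInter₂.2 fun α hα => ?_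
    dsimp only
    split_ifs with hα0
    · have hmem := hUF b hb v hv α hα
      rcases 𝔸.closedHalf_of_mem_closedHalves (h1 α hα) with h | ⟨p, h⟩
      · rw [h]
        trivial
      · have hc : IsClosed {v : V | α v = 0} :=
          isClosed_eq (LinearMap.continuous_of_finiteDimensional _) continuous_const
        have hξ0 : α ξ = 0 := closure_minimal hα0 hc hξ
        rw [h] at hmem ⊢
        simpa only [closedHalf, mem_ofPred_eq, vadd_vsub_assoc, map_add, hξ0, zero_add] using hmem
    · trivial
  · obtain ⟨η, hη⟩ := hF.nonempty
    have := 𝔸.facet_neBot x hF₀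
    obtain ⟨b, hb⟩ := Filter.nonempty_of_mem hU
    set b' : P := η +ᵥ (ξ +ᵥ b) with hb'
    obtain ⟨t, ht, hcone⟩ := D.exists_smul_add_nonneg hFv hη (q -ᵥ b')
    have hinter : ∀ v ∈ Fv, v +ᵥ (ξ +ᵥ b) ∈ E := fun v hv =>
      h3 (mem_iInter₂.2 fun α hα => hUF b hb v hv α hα)
    -- Two points of `E` on the same ray, with parameters `1` and `2`, differ by `η`.
    have hηdir : η ∈ E.direction := by
      have := AffineSubspace.vsub_mem_direction
        (hinter _ (hF.smul_mem hη (t := 2) two_pos)) (hinter η hη)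
      rw [vadd_vsub_vadd_cancel_right, two_smul, add_sub_cancel_right] at this
      exact this
    -- Pushed far along `η`, the point `q` also satisfies the discarded half-spaces: those with root
    -- positive on `Fv` by the choice of `t`, while none other than the whole space can have a root
    -- negative on `Fv`.
    have hqt : t • η +ᵥ q ∈ E := by
      refine h3 (mem_iInter₂.2 fun α hα => ?_)
      rcases 𝔸.closedHalf_of_mem_closedHalves (h1 α hα) with h | ⟨p, h⟩
      · rw [h]
        trivial
      rcases D.sign_on_facet hF hα with h0 | hpos | hneg
      · have hqα := mem_iInter₂.1 hq α hα
        dsimp only at hqα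
        rw [if_pos h0, h] at hqα
        rw [h]
        simpa only [closedHalf, mem_ofPred_eq, vadd_vsub_assoc, map_add, map_smul, h0 η hη,
          smul_zero, zero_add] using hqα
      · have h4 := hcone α hα hpos
        have h5 := hUF b hb η hη α hα
        rw [← hb', h] at h5
        rw [h]
        simp only [closedHalf, mem_ofPred_eq, vadd_vsub_assoc, map_add] at h4 h5 ⊢
        rw [← vsub_add_vsub_cancel q b' p, map_add]
        linarith
      · exfalso
        have hη0 := hneg η hη
        -- The multiple of `η` below has `α`-value `-(|c| + 1)`, which takes the ray out of the
        -- half-space.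
        set c := α ((ξ +ᵥ b) -ᵥ p) with hc
        have hs : 0 < (|c| + 1) / -α η := div_pos (by positivity) (by linarith)
        have h5 := hUF b hb _ (hF.smul_mem hη hs) α hα
        rw [h] at h5
        simp only [closedHalf, mem_ofPred_eq] at h5
        rw [vadd_vsub_assoc, map_add, map_smul, ← hc, smul_eq_mul] at h5
        have h6 : (|c| + 1) / -α η * α η = -(|c| + 1) := by
          rw [div_neg, neg_mul, div_mul_cancel₀ _ hη0.ne]
        linarith [le_abs_self c]
    have := AffineSubspace.vadd_mem_of_mem_direction (E.direction.smul_mem (-t) hηdir) hqt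
    rwa [vadd_vadd, neg_smul, neg_add_cancel, zero_vadd] at this

/-- An element of the affine Weyl group fixing the germ of a full flared chimney is trivial. -/
theorem apply_eq_of_fixes_fullFlaredChimneyGerm [FiniteDimensional ℝ V] {G : Filter P}
    (hG : 𝔸.IsFullFlaredChimneyGerm G) {w : P ≃ᵃ[ℝ] P} {T : Set P} (hT : T ∈ G)
    (hw : ∀ p ∈ T, w p = p) (p : P) : w p = p := by
  obtain ⟨x, F₀, Fv, hF₀, hFv, hfull, rfl⟩ := hG
  have hspan : ((affineSpan ℝ T : AffineSubspace ℝ P) : Set P) ∈ 𝔸.chimneyGerm x F₀ Fv :=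
    mem_of_superset hT (subset_affineSpan ℝ T)
  have htop : affineSpan ℝ T = ⊤ := by
    rw [eq_top_iff, ← hfull]
    exact sInf_le (𝔸.mem_chimney_of_mem_chimneyGerm hF₀ hFv hspan)
  have heq : (w : P →ᵃ[ℝ] P) = AffineMap.id ℝ P :=
    AffineMap.ext_on htop fun p hp => hw p hp
  exact congrArg (fun f => f p) heq

/-- The support has direction `V`, whose only pointwise stabilizer is the identity. This allows the
germ to play the second role in (MA4). -/
theorem isSolidChimneyGerm_of_full {G : Filter P} (hG : 𝔸.IsFullFlaredChimneyGerm G) :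
    𝔸.IsSolidChimneyGerm G := by
  obtain ⟨x, F₀, Fv, hF₀, hFv, hfull, rfl⟩ := hG
  refine ⟨x, F₀, Fv, hF₀, hFv.isVFacet, ?_, rfl⟩
  refine (finite_singleton (1 : V ≃ₗ[ℝ] V)).subset fun w hw => ?_
  ext v
  refine hw.2 v ?_
  rw [hfull, AffineSubspace.direction_top]
  trivial

theorem isFlaredChimneyGerm_of_full {G : Filter P} (hG : 𝔸.IsFullFlaredChimneyGerm G) :
    𝔸.IsFlaredChimneyGerm G := by
  obtain ⟨x, F₀, Fv, hF₀, hFv, -, h⟩ := hG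
  exact ⟨x, F₀, Fv, hF₀, hFv, h⟩

theorem vsub_eq_linear (w : P ≃ᵃ[ℝ] P) (p q : P) : w q -ᵥ w p = w.linear (q -ᵥ p) :=
  ((w : P →ᵃ[ℝ] P).linearMap_vsub q p).symm

theorem Le.map {𝔸 : ModelApartment D P} {w : P ≃ᵃ[ℝ] P} (hw : w ∈ 𝔸.weyl) {p q : P}
    (h : 𝔸.Le p q) : 𝔸.Le (w p) (w q) := by
  rw [Le, vsub_eq_linear]
  exact D.map_mem_titsCone (linear_mem_vWeyl_of_mem_affineWeyl hw) h

theorem Le.refl (p : P) : 𝔸.Le p p := by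
  rw [Le, vsub_self]
  exact D.zero_mem_titsCone

theorem Le.trans [FiniteDimensional ℝ V] {𝔸 : ModelApartment D P} {p q r : P} (h : 𝔸.Le p q)
    (h' : 𝔸.Le q r) : 𝔸.Le p r := by
  rw [Le, ← vsub_add_vsub_cancel r q p]
  exact D.add_mem_titsCone h' h

theorem lineMap_vsub_lineMap (p q : P) (s t : ℝ) :
    (AffineMap.lineMap p q t : P) -ᵥ (AffineMap.lineMap p q s : P) = (t - s) • (q -ᵥ p) := by
  rw [AffineMap.lineMap_apply, AffineMap.lineMap_apply, vadd_vsub_vadd_cancel_right, sub_smul]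

theorem Le.lineMap {𝔸 : ModelApartment D P} {p q : P} (h : 𝔸.Le p q) {s t : ℝ} (hst : s ≤ t) :
    𝔸.Le (AffineMap.lineMap p q s) (AffineMap.lineMap p q t) := by
  rw [Le, lineMap_vsub_lineMap]
  exact D.smul_mem_titsCone h (sub_nonneg.2 hst)

theorem OpenLe.map [FiniteDimensional ℝ V] {𝔸 : ModelApartment D P} {w : P ≃ᵃ[ℝ] P}
    (hw : w ∈ 𝔸.weyl) {p q : P} (h : 𝔸.OpenLe p q) : 𝔸.OpenLe (w p) (w q) := by
  rw [OpenLe, vsub_eq_linear]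
  refine h.imp (D.map_mem_interior_titsCone (linear_mem_vWeyl_of_mem_affineWeyl hw))
    fun h => ?_
  rw [mem_singleton_iff.1 h, map_zero]
  rfl

theorem OpenLe.refl (p : P) : 𝔸.OpenLe p p :=
  Or.inr (vsub_self p)

theorem OpenLe.le {𝔸 : ModelApartment D P} {p q : P} (h : 𝔸.OpenLe p q) : 𝔸.Le p q := by
  rcases h with h | h
  · exact interior_subset h
  · rw [Le, mem_singleton_iff.1 h]
    exact D.zero_mem_titsCone

theorem OpenLe.trans [FiniteDimensional ℝ V] {𝔸 : ModelApartment D P} {p q r : P}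
    (h : 𝔸.OpenLe p q) (h' : 𝔸.OpenLe q r) : 𝔸.OpenLe p r := by
  rw [OpenLe, ← vsub_add_vsub_cancel r q p]
  rcases h' with h1 | h1
  · exact Or.inl (D.add_mem_interior_titsCone h1 h.le)
  · rwa [mem_singleton_iff.1 h1, zero_add]

theorem OpenLe.lineMap {𝔸 : ModelApartment D P} {p q : P} (h : 𝔸.OpenLe p q) {s t : ℝ}
    (hst : s ≤ t) : 𝔸.OpenLe (AffineMap.lineMap p q s) (AffineMap.lineMap p q t) := by
  rw [OpenLe, lineMap_vsub_lineMap]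
  rcases hst.eq_or_lt with rfl | hst
  · exact Or.inr (by rw [sub_self, zero_smul]; rfl)
  · refine h.imp (fun h => D.smul_mem_interior_titsCone h (sub_pos.2 hst)) fun h => ?_
    rw [mem_singleton_iff.1 h, smul_zero]
    rfl

/-- Two comparable points differ by an element of a vectorial facet. -/
theorem exists_facet_of_le {𝔸 : ModelApartment D P} {p q : P} (h : 𝔸.Le p q ∨ 𝔸.Le q p) :
    ∃ Fv, D.IsVFacet Fv ∧ q -ᵥ p ∈ Fv := by
  rcases h with h | h <;> simp only [Le, RootBasis.titsCone, mem_iUnion] at h <;>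
    obtain ⟨w, hw, J, v, hv, hvw⟩ := h
  · exact ⟨_, ⟨J, w, hw, Or.inl rfl⟩, v, hv, hvw⟩
  · refine ⟨_, ⟨J, w, hw, Or.inr rfl⟩, v, hv, ?_⟩
    rw [← neg_vsub_eq_vsub_rev p q, ← hvw]

end ModelApartment

/-! ### Transport between the model apartment and apartments. -/

namespace ApartmentSystem

theorem coe_isom_injective {P X : Type*} {A : Set X} (f : P ≃ A) :
    Function.Injective fun p => (f p : X) :=
  Subtype.val_injective.comp f.injective

theorem mem_push_self {P X : Type*} {A : Set X} (f : P ≃ A) (G : Filter P) : A ∈ push f G :=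
  mem_map.2 (mem_of_superset univ_mem fun p _ => (f p).2)

theorem comap_push {P X : Type*} {A : Set X} (f : P ≃ A) (G : Filter P) :
    (push f G).comap (fun p => (f p : X)) = G :=
  comap_map (coe_isom_injective f)

variable {ι V : Type*} [Fintype ι] [NormedAddCommGroup V] [NormedSpace ℝ V]
  {D : ApartmentRootDatum ι V} {P : Type*} [MetricSpace P] [NormedAddTorsor V P]
  {𝔸 : ModelApartment D P} {X : Type*} {S : ApartmentSystem 𝔸 X}

/-- `isom A` is a single `W`-orbit, so carrying one member to `isom A'` carries all of them. -/
theorem IsIso.trans_mem_isom {A A' : Set X} (hA : A ∈ S.apartments) (hA' : A' ∈ S.apartments)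
    {φ : A ≃ A'} (hφ : S.IsIso φ) {f : P ≃ A} (hf : f ∈ S.isom A) : f.trans φ ∈ S.isom A' := by
  obtain ⟨f₀, hf₀, h₀⟩ := hφ
  obtain ⟨w, hw, h⟩ := (S.isom_iff A hA f₀ hf₀ f).1 hf
  exact (S.isom_iff A' hA' _ h₀ _).2 ⟨w, hw, fun p => congrArg φ (h p)⟩

theorem IsIso.symm {A A' : Set X} {φ : A ≃ A'} (hφ : S.IsIso φ) : S.IsIso φ.symm := by
  obtain ⟨f, hf, h⟩ := hφ
  refine ⟨f.trans φ, h, ?_⟩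
  rwa [Equiv.trans_assoc, Equiv.self_trans_symm, Equiv.trans_refl]

theorem Fixes.symm {A A' : Set X} {φ : A ≃ A'} {F : Filter X} (hA : A ∈ F) (hφ : Fixes φ F) :
    Fixes φ.symm F := by
  obtain ⟨T, hT, h⟩ := hφ
  refine ⟨T ∩ A, inter_mem hT hA, fun a ha => ?_⟩
  have h1 : φ ⟨a, ha.2⟩ = a := Subtype.ext (h _ ha.1)
  rw [φ.symm_apply_eq.2 h1.symm]

/-- An isomorphism given by the axioms fixes the filter itself. -/
theorem EnclosureShared.exists_iso {A A' : Set X} (hA : A ∈ S.apartments) {F : Filter X}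
    (hF : A ∈ F) (h : S.EnclosureShared A A' F) : ∃ φ : A ≃ A', S.IsIso φ ∧ Fixes φ F := by
  obtain ⟨f, hf⟩ := S.isom_nonempty A hA
  obtain ⟨-, φ, hφ, T, hT, hfix⟩ := h f hf
  obtain ⟨U, hU, hUT⟩ := mem_comap.1 (𝔸.le_cl _ (mem_map.1 hT))
  refine ⟨φ, hφ, U ∩ A, inter_mem hU hF, fun a ha => hfix a ?_⟩
  have : f.symm a ∈ (fun p => (f p : X)) ⁻¹' U := by simpa using ha.1
  simpa using hUT this

/-- Two charts differ by an element of `W`, whose linear part preserves the Tits cone. -/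
theorem le_iff {A : Set X} (hA : A ∈ S.apartments) {f : P ≃ A} (hf : f ∈ S.isom A) (p q : P) :
    S.Le A (f p) (f q) ↔ 𝔸.Le p q := by
  refine ⟨?_, fun h => ⟨f, hf, p, q, rfl, rfl, h⟩⟩
  rintro ⟨g, hg, p', q', hp, hq, h⟩
  obtain ⟨w, hw, hgw⟩ := (S.isom_iff A hA f hf g).1 hg
  rw [hgw] at hp hq
  rw [← coe_isom_injective f hp, ← coe_isom_injective f hq]
  exact h.map hw

theorem openLe_iff [FiniteDimensional ℝ V] {A : Set X} (hA : A ∈ S.apartments) {f : P ≃ A}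
    (hf : f ∈ S.isom A) (p q : P) : S.OpenLe A (f p) (f q) ↔ 𝔸.OpenLe p q := by
  refine ⟨?_, fun h => ⟨f, hf, p, q, rfl, rfl, h⟩⟩
  rintro ⟨g, hg, p', q', hp, hq, h⟩
  obtain ⟨w, hw, hgw⟩ := (S.isom_iff A hA f hf g).1 hg
  rw [hgw] at hp hq
  rw [← coe_isom_injective f hp, ← coe_isom_injective f hq]
  exact h.map hw

theorem seg_eq {A : Set X} (hA : A ∈ S.apartments) {f : P ≃ A} (hf : f ∈ S.isom A) (p q : P) :
    S.seg A (f p) (f q) = (fun r => (f r : X)) '' affineSegment ℝ p q := by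
  ext z
  constructor
  · rintro ⟨g, hg, p', q', r, hp, hq, hr, rfl⟩
    obtain ⟨w, hw, hgw⟩ := (S.isom_iff A hA f hf g).1 hg
    rw [hgw] at hp hq
    refine ⟨w r, ?_, by rw [hgw]⟩
    rw [← coe_isom_injective f hp, ← coe_isom_injective f hq]
    have := affineSegment_image (w : P →ᵃ[ℝ] P) p' q'
    exact this ▸ mem_image_of_mem w hr
  · rintro ⟨r, hr, rfl⟩
    exact ⟨f, hf, p, q, r, rfl, rfl, hr, rfl⟩

end ApartmentSystem

/-! ### Existence, uniqueness and local form of the retraction. -/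

namespace AffineHovel

open ApartmentSystem

variable {ι V P X : Type*} [Fintype ι] [NormedAddCommGroup V] [NormedSpace ℝ V]
  [MetricSpace P] [NormedAddTorsor V P]
  {D : ApartmentRootDatum ι V} {𝔸 : ModelApartment D P} (S : AffineHovel 𝔸 X)

/-- A facet of `A` through `x`, contained in every apartment containing `x`. -/
theorem exists_facet_through {A : Set X} (hA : A ∈ S.apartments) {x : X} (hx : x ∈ A) :
    ∃ F : Filter X, S.IsKindIn 𝔸.IsFacet A F ∧ (∀ T ∈ F, x ∈ T) ∧
      ∀ A' ∈ S.apartments, x ∈ A' → A' ∈ F := by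
  obtain ⟨f, hf⟩ := S.isom_nonempty A hA
  set p := f.symm ⟨x, hx⟩ with hp
  have hfp : (f p : X) = x := by simp [hp]
  refine ⟨push f (𝔸.facet p (D.fundFacet univ)),
    ⟨f, hf, _, ⟨_, _, D.isVFacet_fundFacet univ, rfl⟩, rfl⟩, fun T hT => ?_, fun A' hA' hx' => ?_⟩
  · rw [← hfp]
    exact 𝔸.mem_of_mem_facet D.zero_mem_fundFacet_univ (mem_map.1 hT)
  · have hmem : A' ∈ push f (𝓟 {p}) := by
      refine mem_map.2 (mem_principal.2 (singleton_subset_iff.2 ?_))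
      rwa [mem_preimage, hfp]
    -- (MA2) for the point gives its enclosure, which contains the facet of minimal direction.
    have h := (S.ma2 A hA _ (Or.inl ⟨f, hf, _, ⟨p, rfl⟩, rfl⟩) A' hA' hmem f hf).1
    rw [comap_push] at h
    exact mem_of_superset (map_mono (𝔸.facet_univ_le_cl_pure p) h) inter_subset_right

variable {S} {A : Set X} {R : Filter X}

/-- Two apartments containing the germ of a full flared chimney are isomorphic over it. -/
theorem exists_iso_fixes_germ (hA : A ∈ S.apartments)
    (hR : S.IsKindIn 𝔸.IsFullFlaredChimneyGerm A R) {A₁ A₂ : Set X} (h₁ : A₁ ∈ S.apartments)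
    (h₁R : A₁ ∈ R) (h₂ : A₂ ∈ S.apartments) (h₂R : A₂ ∈ R) :
    ∃ φ : A₁ ≃ A₂, S.IsIso φ ∧ Fixes φ R := by
  obtain ⟨f, hf, G, hG, rfl⟩ := hR
  have h := S.ma4 _ _ ⟨A, hA, f, hf, G, 𝔸.isFlaredChimneyGerm_of_full hG, rfl⟩
    (Or.inr ⟨A, hA, f, hf, G, 𝔸.isSolidChimneyGerm_of_full hG, rfl⟩) A₁ h₁ h₁R h₁R A₂ h₂ h₂R h₂R
  rw [sup_idem] at h
  exact h.exists_iso h₁ h₁R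

theorem germ_kind (hA : A ∈ S.apartments) (hR : S.IsKindIn 𝔸.IsFullFlaredChimneyGerm A R) :
    A ∈ R ∧ S.IsKind 𝔸.IsFlaredChimneyGerm R := by
  obtain ⟨f, hf, G, hG, rfl⟩ := hR
  exact ⟨mem_push_self _ _, A, hA, f, hf, G, 𝔸.isFlaredChimneyGerm_of_full hG, rfl⟩

variable [FiniteDimensional ℝ V]

/-- Isomorphisms onto `A` fixing the germ of a full flared chimney agree on common points. -/
theorem iso_apply_eq_of_fixes_germ (hA : A ∈ S.apartments)
    (hR : S.IsKindIn 𝔸.IsFullFlaredChimneyGerm A R) {A₁ A₂ : Set X} (h₁ : A₁ ∈ S.apartments)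
    (h₁R : A₁ ∈ R) (h₂ : A₂ ∈ S.apartments) (h₂R : A₂ ∈ R) {x : X} (hx₁ : x ∈ A₁) (hx₂ : x ∈ A₂)
    {φ₁ : A₁ ≃ A} (hφ₁ : S.IsIso φ₁) (hf₁ : Fixes φ₁ R) {φ₂ : A₂ ≃ A} (hφ₂ : S.IsIso φ₂)
    (hf₂ : Fixes φ₂ R) : φ₁ ⟨x, hx₁⟩ = φ₂ ⟨x, hx₂⟩ := by
  -- (MA4) applies to facets rather than points; as `F` contains `x`, the resulting `ψ` fixes both
  -- `R` and `x`.
  obtain ⟨F, hF, hxF, hFA⟩ := S.exists_facet_through h₁ hx₁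
  obtain ⟨ψ, hψ, T, hT, hfix⟩ := (S.ma4 R F (germ_kind hA hR).2 (Or.inl ⟨A₁, h₁, hF⟩)
    A₁ h₁ h₁R (hFA _ h₁ hx₁) A₂ h₂ h₂R (hFA _ h₂ hx₂)).exists_iso h₁
      (mem_sup.2 ⟨h₁R, hFA _ h₁ hx₁⟩)
  have hψx : ψ ⟨x, hx₁⟩ = ⟨x, hx₂⟩ := Subtype.ext (hfix ⟨x, hx₁⟩ (hxF T hT.2))
  obtain ⟨T₁, hT₁, hfix₁⟩ := hf₁.symm h₁R
  obtain ⟨T₂, hT₂, hfix₂⟩ := hf₂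
  obtain ⟨f, hf, G, hG, rfl⟩ := hR
  -- In the chart `f`, the automorphism `φ₂ ψ φ₁⁻¹` of `A` is an element of `W`. It fixes the full
  -- germ, hence is trivial.
  have hmem : (f.trans φ₁.symm).trans (ψ.trans φ₂) ∈ S.isom A :=
    hφ₂.trans_mem_isom h₂ hA (hψ.trans_mem_isom h₁ h₂ (hφ₁.symm.trans_mem_isom hA h₁ hf))
  obtain ⟨w, -, hw⟩ := (S.isom_iff A hA f hf _).1 hmem
  have hfixw : ∀ p ∈ (fun p => (f p : X)) ⁻¹' (T ∩ T₁ ∩ T₂), w p = p := by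
    rintro p ⟨⟨hp, hp₁⟩, hp₂⟩
    have e₁ : (φ₁.symm (f p) : X) = f p := hfix₁ (f p) hp₁
    have e₂ : (ψ (φ₁.symm (f p)) : X) = f p := (hfix _ (e₁ ▸ hp)).trans e₁
    have e₃ : (φ₂ (ψ (φ₁.symm (f p))) : X) = f p := (hfix₂ _ (e₂ ▸ hp₂)).trans e₂
    exact coe_isom_injective f ((congrArg Subtype.val (hw p)).symm.trans e₃)
  have hw1 := 𝔸.apply_eq_of_fixes_fullFlaredChimneyGerm hG
    (mem_map.1 (inter_mem (inter_mem hT.1 hT₁) hT₂)) hfixw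
  have h := hw (f.symm (φ₁ ⟨x, hx₁⟩))
  rw [hw1] at h
  simpa [hψx] using h.symm

/-- Existence and uniqueness of the retraction centred at the germ of a full flared chimney. -/
theorem existsUnique_isRetraction (hA : A ∈ S.apartments)
    (hR : S.IsKindIn 𝔸.IsFullFlaredChimneyGerm A R) : ∃! ρ : X → A, S.IsRetraction A R ρ := by
  obtain ⟨hAR, hkind⟩ := germ_kind hA hR
  have hex : ∀ x : X, ∃ A' ∈ S.apartments, A' ∈ R ∧ ∃ _ : x ∈ A', ∃ φ : A' ≃ A,
      S.IsIso φ ∧ Fixes φ R := by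
    intro x
    obtain ⟨A₁, h₁, hx₁⟩ : x ∈ ⋃₀ S.apartments := S.sUnion_apartments ▸ mem_univ x
    obtain ⟨F, hF, hxF, -⟩ := S.exists_facet_through h₁ hx₁
    obtain ⟨A', hA', hA'R, hA'F⟩ := S.ma3 R F hkind (Or.inl ⟨A₁, h₁, hF⟩)
    exact ⟨A', hA', hA'R, hxF _ hA'F, exists_iso_fixes_germ hA hR hA' hA'R hA hAR⟩
  choose B hB hBR hxB φ hφ hφR using hex
  refine ⟨fun x => φ x ⟨x, hxB x⟩, fun x => ⟨⟨B x, hB x, hBR x, hxB x, φ x, hφ x, hφR x⟩, ?_⟩, ?_⟩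
  · intro A' hA' hA'R hx ψ hψ hψR
    exact iso_apply_eq_of_fixes_germ hA hR (hB x) (hBR x) hA' hA'R (hxB x) hx (hφ x) (hφR x)
      hψ hψR
  · intro ρ hρ
    funext x
    exact (hρ x).2 (B x) (hB x) (hBR x) (hxB x) (φ x) (hφ x) (hφR x)

/-- On an initial segment of a preordered interval of `A'`, the retraction coincides with an
isomorphism of apartments. -/
theorem exists_isom_eq_retraction (hA : A ∈ S.apartments)
    (hR : S.IsKindIn 𝔸.IsFullFlaredChimneyGerm A R) {ρ : X → A} (hρ : S.IsRetraction A R ρ)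
    {A' : Set X} (hA' : A' ∈ S.apartments) {f : P ≃ A'} (hf : f ∈ S.isom A') {p q : P}
    (hpq : 𝔸.Le p q ∨ 𝔸.Le q p) :
    ∃ ε : ℝ, 0 < ε ∧ ∃ g ∈ S.isom A, ∀ s ∈ Icc 0 ε,
      ρ (f (AffineMap.lineMap p q s)) = g (AffineMap.lineMap p q s) := by
  obtain ⟨hAR, hkind⟩ := germ_kind hA hR
  -- `G` will be the interval germ, or the point when `p = q`. The apartment `A₁` contains `R` and a
  -- facet containing `G`; (MA2) matches it with `A'` along the enclosure of `G`, and `ρ` is an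
  -- isomorphism on `A₁`.
  have key : ∀ G : Filter P, (∀ T ∈ 𝔸.cl G, ∃ ε : ℝ, 0 < ε ∧ ∀ s ∈ Icc 0 ε,
      AffineMap.lineMap p q s ∈ T) → (ModelApartment.IsPoint G ∨ 𝔸.IsPreorderedIntervalGerm G) →
      (∃ Fv, D.IsVFacet Fv ∧ G ≤ 𝔸.facet p Fv) →
      ∃ ε : ℝ, 0 < ε ∧ ∃ g ∈ S.isom A, ∀ s ∈ Icc 0 ε,
        ρ (f (AffineMap.lineMap p q s)) = g (AffineMap.lineMap p q s) := by
    rintro G hG hGkind ⟨Fv, hFv, hGF⟩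
    obtain ⟨A₁, h₁, h₁R, h₁F⟩ := S.ma3 R (push f (𝔸.facet p Fv)) hkind
      (Or.inl ⟨A', hA', f, hf, _, ⟨p, Fv, hFv, rfl⟩, rfl⟩)
    obtain ⟨-, φ, hφ, T, hT, hfix⟩ := S.ma2 A' hA' (push f G)
      (hGkind.imp (fun h => ⟨f, hf, G, h, rfl⟩) fun h => Or.inl ⟨f, hf, G, h, rfl⟩)
      A₁ h₁ (map_mono hGF h₁F) f hf
    rw [comap_push] at hT
    obtain ⟨ε, hε, hsub⟩ := hG _ (mem_map.1 hT)
    obtain ⟨ψ, hψ, hψR⟩ := exists_iso_fixes_germ hA hR h₁ h₁R hA hAR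
    refine ⟨ε, hε, (f.trans φ).trans ψ,
      hψ.trans_mem_isom h₁ hA (hφ.trans_mem_isom hA' h₁ hf), fun s hs => ?_⟩
    have e : (φ (f (AffineMap.lineMap p q s)) : X) = f (AffineMap.lineMap p q s) :=
      hfix _ (hsub s hs)
    rw [← e]
    exact (hρ _).2 A₁ h₁ h₁R (Subtype.coe_prop _) ψ hψ hψR
  rcases eq_or_ne p q with rfl | hne
  · refine key (𝓟 {p}) (fun T hT => ⟨1, one_pos, fun s _ => ?_⟩) (Or.inl ⟨p, rfl⟩)
      ⟨_, D.isVFacet_fundFacet univ, fun T hT => ?_⟩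
    · rw [AffineMap.lineMap_same_apply]
      exact mem_principal.1 (𝔸.le_cl _ hT) (mem_singleton p)
    · exact mem_principal.2
        (singleton_subset_iff.2 (𝔸.mem_of_mem_facet D.zero_mem_fundFacet_univ hT))
  · obtain ⟨Fv, hFv, hmem⟩ := ModelApartment.exists_facet_of_le hpq
    exact key (ModelApartment.intervalGerm p q)
      (fun T hT => 𝔸.exists_lineMap_mem_of_mem_cl_intervalGerm hT)
      (Or.inr ⟨p, q, hne, hpq, rfl⟩) ⟨Fv, hFv, 𝔸.intervalGerm_le_facet hFv hmem⟩

end AffineHovel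

/-! ### Subdivisions of the unit interval. -/

/-- A relation between real numbers which holds on small intervals on both sides of each point
of `[0, 1]` holds on the intervals of some subdivision of `[0, 1]`. -/
theorem exists_subdivision_of_local {r : ℝ → ℝ → Prop}
    (hright : ∀ t ∈ Ico (0 : ℝ) 1, ∃ ε > 0, ∀ u ∈ Icc t (t + ε), r t u)
    (hleft : ∀ t ∈ Ioc (0 : ℝ) 1, ∃ ε > 0, ∀ u ∈ Icc (t - ε) t, r u t) :
    ∃ (n : ℕ) (τ : ℕ → ℝ), τ 0 = 0 ∧ τ n = 1 ∧ ∀ i < n, τ i ≤ τ (i + 1) ∧ r (τ i) (τ (i + 1)) := by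
  set C : ℝ → Prop := fun t =>
    ∃ (n : ℕ) (τ : ℕ → ℝ), τ 0 = 0 ∧ τ n = t ∧ ∀ i < n, τ i ≤ τ (i + 1) ∧ r (τ i) (τ (i + 1))
    with hC
  have hstep : ∀ t u, C t → t ≤ u → r t u → C u := by
    rintro t u ⟨n, τ, h0, hn, h⟩ htu hr
    refine ⟨n + 1, fun i => if i ≤ n then τ i else u, by simpa using h0, by simp, fun i hi => ?_⟩
    rcases (Nat.lt_succ_iff.1 hi).eq_or_lt with rfl | hi'
    · simpa [hn] using ⟨htu, hr⟩
    · simpa [hi'.le, Nat.succ_le_of_lt hi'] using h i hi'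
  -- Requiring `C` on all of `[0, t]` makes `s` closed under decreasing `t`. Closedness in `[0, 1]`
  -- comes from `hleft`, and progress to the right of each point from `hright`.
  set s : Set ℝ := {t | ∀ u ∈ Icc 0 t, C u} with hs
  have h0 : C 0 := ⟨0, fun _ => 0, rfl, rfl, fun i hi => (Nat.not_lt_zero i hi).elim⟩
  have h0s : (0 : ℝ) ∈ s := fun u hu => by
    rw [Icc_self] at hu
    rwa [mem_singleton_iff.1 hu]
  have hclosed : IsClosed (s ∩ Icc 0 1) := by
    refine isClosed_of_closure_subset fun t ht => ?_
    have htI : t ∈ Icc (0 : ℝ) 1 := closure_minimal inter_subset_right isClosed_Icc ht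
    refine ⟨?_, htI⟩
    have hlt : ∀ u, 0 ≤ u → u < t → C u := fun u hu hut => by
      obtain ⟨t', ht', hmem⟩ := mem_closure_iff.1 ht (Ioi u) isOpen_Ioi hut
      exact hmem.1 u ⟨hu, le_of_lt ht'⟩
    intro u hu
    rcases hu.2.eq_or_lt with rfl | hut
    · rcases hu.1.eq_or_lt with h | hpos
      · rwa [← h]
      · obtain ⟨ε, hε, hr⟩ := hleft u ⟨hpos, htI.2⟩
        have hmax : max (u - ε) 0 < u := max_lt (by linarith) hpos
        exact hstep _ _ (hlt _ (le_max_right _ _) hmax) hmax.le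
          (hr _ ⟨le_max_left _ _, hmax.le⟩)
    · exact hlt u hu.1 hut
  have h1s : (1 : ℝ) ∈ s := by
    refine hclosed.mem_of_ge_of_forall_exists_gt h0s zero_le_one fun t ht => ?_
    obtain ⟨ε, hε, hr⟩ := hright t ht.2
    refine ⟨min (t + ε) 1, fun u hu => ?_, lt_min (by linarith) ht.2.2, min_le_right _ _⟩
    rcases le_total u t with h | h
    · exact ht.1 u ⟨hu.1, h⟩
    · exact hstep t u (ht.1 t ⟨ht.2.1, le_rfl⟩) h (hr u ⟨h, hu.2.trans (min_le_left _ _)⟩)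
  exact h1s 1 ⟨zero_le_one, le_rfl⟩

/-- Take the first `k` with `s ≤ τ k`; monotonicity is not needed. If `k = 0` then `s = τ 0`, and
`h0n` rules out that `τ` never exceeds `s`. -/
theorem exists_mem_Icc_of_subdivision {n : ℕ} {τ : ℕ → ℝ} (h0n : τ 0 < τ n) {s : ℝ}
    (hs : s ∈ Icc (τ 0) (τ n)) : ∃ i < n, s ∈ Icc (τ i) (τ (i + 1)) := by
  classical
  have hex : ∃ k, s ≤ τ k := ⟨n, hs.2⟩
  have hle : Nat.find hex ≤ n := Nat.find_min' hex hs.2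
  rcases hk : Nat.find hex with _ | k
  · have h0 : s = τ 0 := le_antisymm (hk ▸ Nat.find_spec hex) hs.1
    by_contra! hno
    have : ∀ k ≤ n, τ k ≤ s := by
      intro k hkn
      induction k with
      | zero => exact h0.ge
      | succ k ih =>
        have h1 := ih (Nat.le_of_succ_le hkn)
        by_contra! h2
        exact hno k hkn ⟨h1, h2.le⟩
    exact (h0 ▸ h0n).not_ge (this n le_rfl)
  · refine ⟨k, by omega, ?_, hk ▸ Nat.find_spec hex⟩
    exact (not_le.1 (Nat.find_min hex (m := k) (by omega))).le

theorem affineSegment_lineMap {V P : Type*} [NormedAddCommGroup V] [NormedSpace ℝ V]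
    [MetricSpace P] [NormedAddTorsor V P] (p q : P) {a b : ℝ} (hab : a ≤ b) :
    affineSegment ℝ (AffineMap.lineMap p q a : P) (AffineMap.lineMap p q b) =
      AffineMap.lineMap p q '' Icc a b := by
  rw [← affineSegment_image (AffineMap.lineMap p q : ℝ →ᵃ[ℝ] P) a b, affineSegment_eq_segment,
    segment_eq_Icc hab]

/-! ### Images of preordered segments. -/

namespace AffineHovel

open ApartmentSystem

variable {ι V P X : Type*} [Fintype ι] [NormedAddCommGroup V] [NormedSpace ℝ V]
  [FiniteDimensional ℝ V] [MetricSpace P] [NormedAddTorsor V P]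
  {D : ApartmentRootDatum ι V} {𝔸 : ModelApartment D P} {S : AffineHovel 𝔸 X}
  {A : Set X} {R : Filter X}

/-- A preordered segment has a subdivision on each piece of which the retraction coincides with
an isomorphism of apartments. -/
theorem exists_subdivision_isom (hA : A ∈ S.apartments)
    (hR : S.IsKindIn 𝔸.IsFullFlaredChimneyGerm A R) {ρ : X → A} (hρ : S.IsRetraction A R ρ)
    {A' : Set X} (hA' : A' ∈ S.apartments) {f : P ≃ A'} (hf : f ∈ S.isom A') {p q : P}
    (hpq : 𝔸.Le p q) :
    ∃ (n : ℕ) (τ : ℕ → ℝ), τ 0 = 0 ∧ τ n = 1 ∧ ∀ i < n, τ i ≤ τ (i + 1) ∧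
      ∃ g ∈ S.isom A, ∀ s ∈ Icc (τ i) (τ (i + 1)),
        ρ (f (AffineMap.lineMap p q s)) = g (AffineMap.lineMap p q s) := by
  refine exists_subdivision_of_local (r := fun a b => ∃ g ∈ S.isom A, ∀ s ∈ Icc a b,
    ρ (f (AffineMap.lineMap p q s)) = g (AffineMap.lineMap p q s)) (fun t ht => ?_) fun t ht => ?_
  -- To the right of `t`, use the interval from the current point to `q`; the factor `1 - t`
  -- converts its parameter to that of `[p, q]`.
  · have hle : 𝔸.Le (AffineMap.lineMap p q t) q := by
      simpa using hpq.lineMap ht.2.le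
    obtain ⟨ε, hε, g, hg, h⟩ := exists_isom_eq_retraction hA hR hρ hA' hf (Or.inl hle)
    have ht1 : 0 < 1 - t := sub_pos.2 ht.2
    refine ⟨ε * (1 - t), mul_pos hε ht1, fun u hu => ⟨g, hg, fun s hs => ?_⟩⟩
    have hs' : (s - t) / (1 - t) ∈ Icc 0 ε :=
      ⟨div_nonneg (by linarith [hs.1]) ht1.le, (div_le_iff₀ ht1).2 (by linarith [hs.2, hu.2])⟩
    have e : AffineMap.lineMap (AffineMap.lineMap p q t : P) q ((s - t) / (1 - t)) =
        (AffineMap.lineMap p q s : P) := by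
      rw [AffineMap.lineMap_lineMap_left]
      congr 1
      field_simp
      ring
    have := h _ hs'
    rwa [e] at this
  -- To the left of `t`, use the interval run backwards towards `p`, with factor `t`; this is why
  -- the local result allows either order of the endpoints.
  · have hle : 𝔸.Le p (AffineMap.lineMap p q t) := by
      simpa using hpq.lineMap ht.1.le
    obtain ⟨ε, hε, g, hg, h⟩ := exists_isom_eq_retraction hA hR hρ hA' hf (Or.inr hle)
    refine ⟨ε * t, mul_pos hε ht.1, fun u hu => ⟨g, hg, fun s hs => ?_⟩⟩
    have hs' : 1 - s / t ∈ Icc 0 ε := by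
      have h1 : s / t ≤ 1 := (div_le_one ht.1).2 hs.2
      have h2 : 1 - ε ≤ s / t := (le_div_iff₀ ht.1).2 (by linarith [hs.1, hu.1])
      exact ⟨by linarith, by linarith⟩
    have e : AffineMap.lineMap (AffineMap.lineMap p q t : P) p (1 - s / t) =
        (AffineMap.lineMap p q s : P) := by
      rw [AffineMap.lineMap_apply_one_sub, AffineMap.lineMap_lineMap_right,
        div_mul_cancel₀ _ ht.1.ne']
    have := h _ hs'
    rwa [e] at this

/-- An abstract relation `rel` serves both preorders: it has to be reflexive and transitive on `A`
and to hold along the line `p q` in every chart of `A`. -/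
theorem mapsToIncreasingBrokenLine (hA : A ∈ S.apartments)
    (hR : S.IsKindIn 𝔸.IsFullFlaredChimneyGerm A R) {ρ : X → A} (hρ : S.IsRetraction A R ρ)
    {A' : Set X} (hA' : A' ∈ S.apartments) {f : P ≃ A'} (hf : f ∈ S.isom A') {p q : P}
    (hpq : 𝔸.Le p q) {rel : X → X → Prop} (hrefl : ∀ a : A, rel a a)
    (htrans : ∀ a b c : A, rel a b → rel b c → rel a c)
    (hrel : ∀ g ∈ S.isom A, ∀ s t : ℝ, s ≤ t →
      rel (g (AffineMap.lineMap p q s)) (g (AffineMap.lineMap p q t))) :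
    S.MapsToIncreasingBrokenLine A A' ρ rel (f p) (f q) ∧ rel (ρ (f p)) (ρ (f q)) := by
  obtain ⟨n, τ, h0, hn, h⟩ := exists_subdivision_isom hA hR hρ hA' hf hpq
  have hstep : ∀ i < n, rel (ρ (f (AffineMap.lineMap p q (τ i))))
      (ρ (f (AffineMap.lineMap p q (τ (i + 1))))) := fun i hi => by
    obtain ⟨hle, g, hg, hgρ⟩ := h i hi
    rw [hgρ _ ⟨le_rfl, hle⟩, hgρ _ ⟨hle, le_rfl⟩]
    exact hrel g hg _ _ hle
  have hseg : ∀ a b : ℝ, a ≤ b →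
      S.seg A' (f (AffineMap.lineMap p q a)) (f (AffineMap.lineMap p q b)) =
        (fun s : ℝ => (f (AffineMap.lineMap p q s) : X)) '' Icc a b := fun a b hab => by
    rw [seg_eq hA' hf, affineSegment_lineMap p q hab, image_image]
  have hpiece : ∀ i < n, (fun u => (ρ u : X)) '' S.seg A' (f (AffineMap.lineMap p q (τ i)))
        (f (AffineMap.lineMap p q (τ (i + 1)))) =
      S.seg A (ρ (f (AffineMap.lineMap p q (τ i))))
        (ρ (f (AffineMap.lineMap p q (τ (i + 1))))) := fun i hi => by
    obtain ⟨hle, g, hg, hgρ⟩ := h i hi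
    rw [hseg _ _ hle, hgρ _ ⟨le_rfl, hle⟩, hgρ _ ⟨hle, le_rfl⟩, seg_eq hA hg,
      affineSegment_lineMap p q hle, image_image, image_image]
    exact image_congr fun s hs => congrArg Subtype.val (hgρ s hs)
  have hmono : Monotone fun i : Fin (n + 1) => τ i :=
    Fin.monotone_iff_le_succ.2 fun i => (h i i.2).1
  refine ⟨⟨n, fun i => f (AffineMap.lineMap p q (τ i)), ?_, ?_, fun i => ⟨hpiece i i.2, hstep i i.2⟩⟩,
    ?_⟩
  · exact ⟨f, hf, p, q, rfl, rfl, fun i => τ i, hmono, h0, hn, fun i => rfl⟩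
  · have hp : ∀ i : Fin n, S.seg A (ρ (f (AffineMap.lineMap p q (τ i.castSucc))))
        (ρ (f (AffineMap.lineMap p q (τ i.succ)))) =
        (fun u => (ρ u : X)) '' S.seg A' (f (AffineMap.lineMap p q (τ i.castSucc)))
          (f (AffineMap.lineMap p q (τ i.succ))) := fun i => (hpiece i i.2).symm
    -- Images commute with unions, so after removing `ρ` and the parametrization the claim is that
    -- the intervals of the subdivision cover `[0, 1]`.
    simp only [hp]
    rw [← image_iUnion]
    congr 1
    have h01 := hseg 0 1 zero_le_one
    rw [AffineMap.lineMap_apply_zero, AffineMap.lineMap_apply_one] at h01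
    rw [h01]
    have hs : ∀ i : Fin n, S.seg A' (f (AffineMap.lineMap p q (τ i.castSucc)))
        (f (AffineMap.lineMap p q (τ i.succ))) =
        (fun s : ℝ => (f (AffineMap.lineMap p q s) : X)) '' Icc (τ i) (τ (i + 1)) :=
      fun i => hseg _ _ (h i i.2).1
    simp only [hs]
    rw [← image_iUnion]
    congr 1
    refine Subset.antisymm (fun s hs => ?_) (iUnion_subset fun i => Icc_subset_Icc ?_ ?_)
    · rw [← h0, ← hn] at hs
      obtain ⟨i, hi, hsi⟩ := exists_mem_Icc_of_subdivision (by rw [h0, hn]; exact zero_lt_one) hs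
      exact mem_iUnion.2 ⟨⟨i, hi⟩, hsi⟩
    · rw [← h0]
      exact hmono (Fin.zero_le i.castSucc)
    · rw [← hn]
      exact hmono (Fin.le_last i.succ)
  · have hall : ∀ k ≤ n, rel (ρ (f (AffineMap.lineMap p q (τ 0))))
        (ρ (f (AffineMap.lineMap p q (τ k)))) := by
      intro k hk
      induction k with
      | zero => exact hrefl _
      | succ k ih => exact htrans _ _ _ (ih (Nat.le_of_succ_le hk)) (hstep k hk)
    simpa [h0, hn] using hall n le_rfl

end AffineHovel

theorem mainTheorem8 {ι V P X : Type*} [Fintype ι]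
    [NormedAddCommGroup V] [NormedSpace ℝ V] [FiniteDimensional ℝ V]
    [MetricSpace P] [NormedAddTorsor V P]
    {D : ApartmentRootDatum ι V} {𝔸 : ModelApartment D P} (S : AffineHovel 𝔸 X)
    (A : Set X) (hA : A ∈ S.apartments) (R : Filter X)
    (hR : S.IsKindIn 𝔸.IsFullFlaredChimneyGerm A R) :
    (∃! ρ : X → A, S.IsRetraction A R ρ) ∧
    ∀ ρ : X → A, S.IsRetraction A R ρ →
      ∀ A' ∈ S.apartments, ∀ x ∈ A', ∀ y ∈ A',
        (S.Le A' x y →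
          S.MapsToIncreasingBrokenLine A A' ρ (S.Le A) x y ∧ S.Le A (ρ x) (ρ y)) ∧
        (S.OpenLe A' x y →
          S.MapsToIncreasingBrokenLine A A' ρ (S.OpenLe A) x y ∧ S.OpenLe A (ρ x) (ρ y)) := by
  refine ⟨AffineHovel.existsUnique_isRetraction hA hR, fun ρ hρ A' hA' x _ y _ => ⟨?_, ?_⟩⟩
  all_goals
    rintro ⟨f, hf, p, q, rfl, rfl, hpq⟩
    obtain ⟨g, hg⟩ := S.isom_nonempty A hA
  · refine AffineHovel.mapsToIncreasingBrokenLine hA hR hρ hA' hf hpq ?_ ?_ ?_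
    · intro a
      obtain ⟨p, rfl⟩ := g.surjective a
      exact (ApartmentSystem.le_iff hA hg p p).2 (ModelApartment.Le.refl 𝔸 p)
    · intro a b c
      obtain ⟨p, rfl⟩ := g.surjective a
      obtain ⟨q, rfl⟩ := g.surjective b
      obtain ⟨r, rfl⟩ := g.surjective c
      simp only [ApartmentSystem.le_iff hA hg]
      exact ModelApartment.Le.trans
    · intro k hk s t hst
      exact (ApartmentSystem.le_iff hA hk _ _).2 (hpq.lineMap hst)
  -- The subdivision needs only `≤`; the stronger relation enters through `rel` alone.
  · refine AffineHovel.mapsToIncreasingBrokenLine hA hR hρ hA' hf hpq.le ?_ ?_ ?_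
    · intro a
      obtain ⟨p, rfl⟩ := g.surjective a
      exact (ApartmentSystem.openLe_iff hA hg p p).2 (ModelApartment.OpenLe.refl 𝔸 p)
    · intro a b c
      obtain ⟨p, rfl⟩ := g.surjective a
      obtain ⟨q, rfl⟩ := g.surjective b
      obtain ⟨r, rfl⟩ := g.surjective c
      simp only [ApartmentSystem.openLe_iff hA hg]
      exact ModelApartment.OpenLe.trans
    · intro k hk s t hst
      exact (ApartmentSystem.openLe_iff hA hk _ _).2 (hpq.lineMap hst)
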